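/- Let $(\Omega,\mathcal F,\mathbb P)$ be a non-atomic probability space, i.e. every measurable set of positive probability contains a measurable subset of strictly smaller positive probability. Let $L^0$ be the space of real random variables modulo a.s. equality, and write $X\sim Y$ if $X$ and $Y$ have the same law. A rearrangement-invariant (r.i.) space is a linear subspace $\mathcal X\ne\{0\}$ of $L^0$ with a complete norm such that for every $X\in\mathcal X$: if $Y\in L^0$ and $|Y|\le|X|$ a.s., then $Y\in\mathcal X$ and $\|Y\|\le\|X\|$; if $Z\in L^0$ and $Z\sim X$, then $Z\in\mathcal X$ and $\|Z\|=\|X\|$. (Such a space always contains $L^\infty$.) Put $$\mathcal X_a=\Big\{X\in\mathcal X:\ \lim_{\mathbb P(A)\to0}\|X\mathbf 1_A\|=0\Big\},\qquad X^-=\max\{-X,0\}.$$ Let $\rho:\mathcal X\to\mathbb R$. It is decreasing if $\rho(X)\le\rho(Y)$ whenever $X\ge Y$ a.s.; law-invariant if $\rho(X)=\rho(Y)$ whenever $X\sim Y$; convex if $\rho(\lambda X+(1-\lambda)Y)\le\lambda\rho(X)+(1-\lambda)\rho(Y)$ for all $X,Y\in\mathcal X$ and $\lambda\in[0,1]$.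 It is a coherent risk measure if it is decreasing, $\rho(X+Y)\le\rho(X)+\rho(Y)$, $\rho(\lambda X)=\lambda\rho(X)$ for real $\lambda\ge0$, and $\rho(X+m\mathbf 1)=\rho(X)-m$ for $m\in\mathbb R$. It has the Fatou property at $X\in\mathcal X$ if $\rho(X)\le\liminf_n\rho(X_n)$ for every sequence $(X_n)$ in $\mathcal X$ with $X_n\to X$ a.s. for which some $X_0\in\mathcal X$ satisfies $|X_n|\le X_0$ a.s. for all $n$. Theorem. Let $\mathcal X$ be an r.i. space over a non-atomic probability space with $\mathcal X\ne L^\infty$ (as sets). The following are equivalent: 1. every law-invariant coherent risk measure $\rho:\mathcal X\to\mathbb R$ has the Fatou property at $0$; 2. every convex, decreasing, law-invariant functional $\rho:\mathcal X\to\mathbb R$ has the Fatou property at every $X\in\mathcal X$ with $X^-\in\mathcal X_a$; 3. $\mathcal X$ has the Almost Order Continuous Equidistributional Average (AOCEA) property: for every $X\in\mathcal X$ with $X\ge0$, $$\inf\big\{\|Y-V\|:\ Y\in\mathrm{co}\{Z: Z\sim X\},\ V\in\mathcal X_a\big\}=0,$$ where $\mathrm{co}$ denotes the convex hull. -/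

import Mathlib

open MeasureTheory ProbabilityTheory Filter Topology

/-- A measure is non-atomic if every measurable set of positive measure contains a measurable
subset of strictly smaller positive measure. (This is stronger than points being null.) -/
def IsNonatomic {Ω : Type*} [MeasurableSpace Ω] (μ : Measure Ω) : Prop :=
  ∀ A : Set Ω, MeasurableSet A → 0 < μ A →
    ∃ B : Set Ω, MeasurableSet B ∧ B ⊆ A ∧ 0 < μ B ∧ μ B < μ A

/-- A rearrangement-invariant space over `(Ω, μ)`: a nonzero Banach space of (a.e. classes of)
real random variables which is solid and invariant under equality in law. -/
structure RISpace {Ω : Type*} [MeasurableSpace Ω] (μ : Measure Ω) where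
  /-- the underlying linear subspace of `L⁰` -/
  space : Submodule ℝ (Ω →ₘ[μ] ℝ)
  /-- the norm -/
  nrm : space → ℝ
  nrm_nonneg : ∀ X, 0 ≤ nrm X
  eq_zero_of_nrm : ∀ X, nrm X = 0 → X = 0
  nrm_smul : ∀ (c : ℝ) X, nrm (c • X) = |c| * nrm X
  nrm_add_le : ∀ X Y, nrm (X + Y) ≤ nrm X + nrm Y
  /-- completeness: every Cauchy sequence converges -/
  complete : ∀ u : ℕ → space,
    (∀ ε : ℝ, 0 < ε → ∃ N, ∀ m ≥ N, ∀ n ≥ N, nrm (u m - u n) < ε) →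
      ∃ X, Tendsto (fun n => nrm (u n - X)) atTop (𝓝 0)
  nontrivial : ∃ X : space, X ≠ 0
  /-- solidity: `|Y| ≤ |X|` a.s. and `X ∈ space` imply `Y ∈ space` and `‖Y‖ ≤ ‖X‖` -/
  solid : ∀ (X : space) (Y : Ω →ₘ[μ] ℝ),
    (∀ᵐ ω ∂μ, |Y ω| ≤ |(X : Ω →ₘ[μ] ℝ) ω|) → ∃ h : Y ∈ space, nrm ⟨Y, h⟩ ≤ nrm X
  /-- rearrangement invariance: `Z ∼ X` and `X ∈ space` imply `Z ∈ space` and `‖Z‖ = ‖X‖` -/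
  rearrangement : ∀ (X : space) (Z : Ω →ₘ[μ] ℝ),
    IdentDistrib Z (X : Ω →ₘ[μ] ℝ) μ μ → ∃ h : Z ∈ space, nrm ⟨Z, h⟩ = nrm X

namespace RISpace

variable {Ω : Type*} [MeasurableSpace Ω] {μ : Measure Ω}

instance instNorm (E : RISpace μ) : Norm E.space := ⟨E.nrm⟩

theorem normedCore (E : RISpace μ) : NormedSpace.Core ℝ E.space where
  norm_nonneg := E.nrm_nonneg
  norm_smul := E.nrm_smul
  norm_triangle := E.nrm_add_le
  norm_eq_zero_iff X := by
    refine ⟨E.eq_zero_of_nrm X, ?_⟩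
    rintro rfl
    have h := E.nrm_smul 0 0
    rw [zero_smul, abs_zero, zero_mul] at h
    exact h

noncomputable instance instNormedAddCommGroup (E : RISpace μ) : NormedAddCommGroup E.space :=
  NormedAddCommGroup.ofCore E.normedCore

noncomputable instance instNormedSpace (E : RISpace μ) : NormedSpace ℝ E.space :=
  NormedSpace.ofCore E.normedCore

/-- `X ∼ Y`: the two random variables have the same law. -/
def SameLaw {E : RISpace μ} (X Y : E.space) : Prop :=
  IdentDistrib (X : Ω →ₘ[μ] ℝ) (Y : Ω →ₘ[μ] ℝ) μ μ

/-- The random variable `X 1_A`, an element of the space by solidity. -/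
noncomputable def restrict {E : RISpace μ} (X : E.space) (A : Set Ω) (hA : MeasurableSet A) :
    E.space :=
  ⟨AEEqFun.mk (A.indicator (X : Ω →ₘ[μ] ℝ)) ((X : Ω →ₘ[μ] ℝ).aestronglyMeasurable.indicator hA),
    (E.solid X _ (by
      filter_upwards [AEEqFun.coeFn_mk (A.indicator (X : Ω →ₘ[μ] ℝ))
        ((X : Ω →ₘ[μ] ℝ).aestronglyMeasurable.indicator hA)] with ω hω
      rw [hω]
      by_cases h : ω ∈ A <;> simp [h])).1⟩

/-- The negative part `X⁻ = max (-X) 0`, an element of the space by solidity. -/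
noncomputable def negPart {E : RISpace μ} (X : E.space) : E.space :=
  ⟨(-(X : Ω →ₘ[μ] ℝ)) ⊔ 0, (E.solid X _ (by
      filter_upwards [AEEqFun.coeFn_sup (-(X : Ω →ₘ[μ] ℝ)) 0,
        AEEqFun.coeFn_neg (X : Ω →ₘ[μ] ℝ), AEEqFun.coeFn_zero (μ := μ) (β := ℝ)] with ω h1 h2 h3
      rw [h1, h2, h3]
      simp only [Pi.neg_apply, Pi.zero_apply]
      rw [abs_of_nonneg (le_max_right _ _)]
      exact max_le (neg_le_abs _) (abs_nonneg _))).1⟩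

/-- The order continuous part: all `X` with `‖X 1_A‖ → 0` as `μ A → 0`. -/
def orderContinuousPart (E : RISpace μ) : Set E.space :=
  {X | ∀ ε : ℝ, 0 < ε → ∃ δ : ℝ, 0 < δ ∧
    ∀ (A : Set Ω) (hA : MeasurableSet A), μ A < ENNReal.ofReal δ → ‖restrict X A hA‖ < ε}

/-- The convex hull of all random variables having the same law as `X`. -/
def equidistributedHull {E : RISpace μ} (X : E.space) : Set E.space :=
  convexHull ℝ {Y : E.space | SameLaw Y X}

/-- The distance `inf {‖X - Y‖ : X ∈ A, Y ∈ B}` of two sets. -/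
noncomputable def setDist {E : RISpace μ} (A B : Set E.space) : ℝ :=
  sInf (Set.image2 (fun X Y => ‖X - Y‖) A B)

/-- The Almost Order Continuous Equidistributional Average property. -/
def AOCEA (E : RISpace μ) : Prop :=
  ∀ X : E.space, 0 ≤ (X : Ω →ₘ[μ] ℝ) → setDist (equidistributedHull X) E.orderContinuousPart = 0

/-- Order convergence of a sequence: a.s. convergence, dominated by an element of the space. -/
def OrderConverges {E : RISpace μ} (u : ℕ → E.space) (X : E.space) : Prop :=
  (∀ᵐ ω ∂μ, Tendsto (fun n => (u n : Ω →ₘ[μ] ℝ) ω) atTop (𝓝 ((X : Ω →ₘ[μ] ℝ) ω))) ∧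
    ∃ X₀ : E.space, ∀ n, ∀ᵐ ω ∂μ, |(u n : Ω →ₘ[μ] ℝ) ω| ≤ (X₀ : Ω →ₘ[μ] ℝ) ω

/-- The Fatou property of a real-valued functional at `X`; the lower limit is taken in the
extended reals. -/
def FatouAt {E : RISpace μ} (ρ : E.space → ℝ) (X : E.space) : Prop :=
  ∀ u : ℕ → E.space, OrderConverges u X →
    ((ρ X : ℝ) : EReal) ≤ liminf (fun n => ((ρ (u n) : ℝ) : EReal)) atTop

def LawInvariant {E : RISpace μ} (ρ : E.space → ℝ) : Prop :=
  ∀ X Y : E.space, SameLaw X Y → ρ X = ρ Y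

def IsDecreasing {E : RISpace μ} (ρ : E.space → ℝ) : Prop :=
  ∀ X Y : E.space, (Y : Ω →ₘ[μ] ℝ) ≤ (X : Ω →ₘ[μ] ℝ) → ρ X ≤ ρ Y

/-- Real-valued coherent risk measures. In `cash`, the element `Y` is `X + m 1`; over a
non-atomic probability space the space contains all constants, so that such a `Y` exists
for all `X` and `m`. -/
structure IsCoherentRiskMeasure {E : RISpace μ} (ρ : E.space → ℝ) : Prop where
  decreasing : IsDecreasing ρ
  subadditive : ∀ X Y : E.space, ρ (X + Y) ≤ ρ X + ρ Y
  pos_homogeneous : ∀ (c : ℝ) (X : E.space), 0 ≤ c → ρ (c • X) = c * ρ X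
  cash : ∀ (X Y : E.space) (m : ℝ),
    (Y : Ω →ₘ[μ] ℝ) = (X : Ω →ₘ[μ] ℝ) + AEEqFun.const Ω m → ρ Y = ρ X - m

end RISpace

/-! Write 𝒳ₐ for the order continuous part. On a nonatomic space every law can be realized on every
set of the right mass, so values may be moved around freely. Since 𝒳 ≠ L^∞, the constants lie in 𝒳ₐ
(`one_mem_orderContinuousPart`).

AOCEA gives Fatou (`AOCEA.fatouAt`). Let U be a late term of a sequence converging to X and
dominated by X₀. The danger lies in large values of U, which are bounded by those of X₀. AOCEA
yields copies Z_i of X₀ with an average ∑ l_i Z_i whose tails have small norm. Raise U to Y by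
putting X₀ on {X₀ > t}, and rearrange Y into W_i which place these large values in the joint pattern
of the Z_i. Then ∑ l_i W_i ≤ X + R with R ≥ 0 of small norm (`exists_sum_sameLaw_le`); X⁻ ∈ 𝒳ₐ pays
for the small set on which values are moved and X may be very negative. Hence ρ(U) ≥ ρ(Y) = ∑ l_i
ρ(W_i) ≥ ρ(∑ l_i W_i) ≥ ρ(X + R), and ρ(X + R) is at least almost ρ(X) by automatic continuity
(`exists_sub_le_of_convexOn`).

Fatou at 0 gives AOCEA (`AOCEA_of_forall_fatouAt`). If AOCEA fails at X ≥ 0, Hahn–Banach yields a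
positive φ that vanishes on 𝒳ₐ and is at least c > 0 on all copies of X
(`exists_singular_functional`). Add a positive ψ with ψ(1) = 1 and let ρ(Y) = -inf {(ψ + φ)(Z) : Z ∼
Y}. This is coherent because a copy of a sum splits, up to ε, into copies of the summands
(`lawInf_add_le`). The variables X 1_{X > n} order converge to 0 but differ from X by bounded
variables, which φ does not see; so ρ ≤ -c along them, while ρ(0) = 0.

The remaining implication holds because coherent functionals are convex and 0⁻ = 0. -/

namespace IsNonatomic

/-! ### Small sets and diffuse variables on a nonatomic space -/

variable {Ω : Type*} [MeasurableSpace Ω] {μ : Measure Ω}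

/-- Nonatomicity splits a set into two pieces of positive measure, and the smaller one has at most
half the mass. -/
theorem exists_subset_two_pow_mul_le [IsFiniteMeasure μ] (hμ : IsNonatomic μ) {A : Set Ω}
    (hA : MeasurableSet A) (hA0 : 0 < μ A) (n : ℕ) :
    ∃ B, MeasurableSet B ∧ B ⊆ A ∧ 0 < μ B ∧ 2 ^ n * μ B ≤ μ A := by
  induction n with
  | zero => exact ⟨A, hA, subset_rfl, hA0, by simp⟩
  | succ n ih =>
    obtain ⟨B, hB, hBA, hB0, hBn⟩ := ih
    obtain ⟨C, hC, hCB, hC0, hClt⟩ := hμ B hB hB0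
    have hsum : μ C + μ (B \ C) = μ B := by
      rw [← measure_union Set.disjoint_sdiff_right (hB.diff hC), Set.union_sdiff_cancel hCB]
    have hD0 : 0 < μ (B \ C) := by
      rw [pos_iff_ne_zero]
      intro h
      rw [h, add_zero] at hsum
      exact hClt.ne hsum
    rcases le_total (μ C) (μ (B \ C)) with h | h
    · refine ⟨C, hC, hCB.trans hBA, hC0, ?_⟩
      calc 2 ^ (n + 1) * μ C = 2 ^ n * (μ C + μ C) := by ring
        _ ≤ 2 ^ n * μ B := by rw [← hsum]; gcongr
        _ ≤ μ A := hBn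
    · refine ⟨B \ C, hB.diff hC, Set.sdiff_subset.trans hBA, hD0, ?_⟩
      calc 2 ^ (n + 1) * μ (B \ C) = 2 ^ n * (μ (B \ C) + μ (B \ C)) := by ring
        _ ≤ 2 ^ n * μ B := by rw [← hsum]; gcongr
        _ ≤ μ A := hBn

theorem exists_subset_le [IsFiniteMeasure μ] (hμ : IsNonatomic μ) {A : Set Ω}
    (hA : MeasurableSet A) (hA0 : 0 < μ A) {ε : ENNReal} (hε : 0 < ε) :
    ∃ B, MeasurableSet B ∧ B ⊆ A ∧ 0 < μ B ∧ μ B ≤ ε := by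
  obtain ⟨n, hn⟩ : ∃ n : ℕ, μ A / ε < n :=
    ENNReal.exists_nat_gt (ENNReal.div_ne_top (measure_ne_top μ A) hε.ne')
  obtain ⟨B, hB, hBA, hB0, hBn⟩ := hμ.exists_subset_two_pow_mul_le hA hA0 n
  refine ⟨B, hB, hBA, hB0, ?_⟩
  by_contra! h
  have h1 : μ A ≤ n * ε := by
    rw [← ENNReal.div_le_iff_le_mul (Or.inl hε.ne') (Or.inr (hn.ne_bot))]
    exact hn.le
  have h2 : (n : ENNReal) ≤ 2 ^ n := by exact_mod_cast Nat.lt_two_pow_self.le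
  have h4 : μ A < 2 ^ n * μ B := by
    refine (h1.trans (mul_le_mul_left h2 ε)).trans_lt ?_
    exact ENNReal.mul_lt_mul_right (by simp) (by simp) h
  exact absurd hBn (not_le.2 h4)

/-- Up to a null set, a nonatomic space is a countable union of sets of small measure. -/
theorem exists_iUnion_eq_univ [IsFiniteMeasure μ] (hμ : IsNonatomic μ) {ε : ENNReal}
    (hε : 0 < ε) :
    ∃ B : ℕ → Set Ω, (∀ n, MeasurableSet (B n)) ∧ (∀ n, μ (B n) ≤ ε) ∧ ⋃ n, B n = Set.univ := by
  -- Exhaustion: merging a maximizing sequence of countable families gives a family `D` whose union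
  -- has the largest possible measure. A complement of positive measure would contain a further
  -- small set.
  let S : Set (ℕ → Set Ω) := {B | (∀ n, MeasurableSet (B n)) ∧ ∀ n, μ (B n) ≤ ε}
  have hS : Nonempty S := ⟨⟨fun _ => ∅, by simp [S]⟩⟩
  obtain ⟨u, -, hu⟩ := exists_seq_tendsto_sSup (S := Set.range fun B : S => μ (⋃ n, B.1 n))
    (Set.range_nonempty _) (OrderTop.bddAbove _)
  choose C hC using fun n => (hu.2 n)
  let D : ℕ → Set Ω := fun n => (C n.unpair.1).1 n.unpair.2
  have hD : D ∈ S := ⟨fun n => (C n.unpair.1).2.1 _, fun n => (C n.unpair.1).2.2 _⟩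
  have hCD : ∀ k, u k ≤ μ (⋃ n, D n) := by
    intro k
    rw [← hC k]
    refine measure_mono (Set.iUnion_subset fun n => ?_)
    refine Set.subset_iUnion_of_subset (Nat.pair k n) ?_
    simp [D]
  have hmax : ∀ B ∈ S, μ (⋃ n, B n) ≤ μ (⋃ n, D n) := fun B hB =>
    (le_sSup (Set.mem_range_self (⟨B, hB⟩ : S))).trans (le_of_tendsto' hu.1 hCD)
  have hDm : MeasurableSet (⋃ n, D n) := MeasurableSet.iUnion hD.1
  have hnull : μ (⋃ n, D n)ᶜ = 0 := by
    by_contra h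
    obtain ⟨B, hB, hBD, hB0, hBε⟩ := hμ.exists_subset_le hDm.compl (pos_iff_ne_zero.2 h) hε
    have h1 := hmax (fun n => Nat.casesOn n B D)
      ⟨fun n => by cases n <;> simp [hB, hD.1], fun n => by cases n <;> simp [hBε, hD.2]⟩
    have h2 : (⋃ n, (Nat.casesOn n B D : Set Ω)) = B ∪ ⋃ n, D n := by
      ext x
      simp only [Set.mem_iUnion, Set.mem_union]
      constructor
      · rintro ⟨n, hn⟩
        cases n with
        | zero => exact Or.inl hn
        | succ n => exact Or.inr ⟨n, hn⟩
      · rintro (hx | ⟨n, hn⟩)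
        exacts [⟨0, hx⟩, ⟨n + 1, hn⟩]
    rw [h2, measure_union (Set.disjoint_left.2 fun x hx => hBD hx) hDm] at h1
    have h3 : μ (⋃ n, D n) < μ B + μ (⋃ n, D n) := by
      rw [add_comm]
      exact ENNReal.lt_add_right (measure_ne_top _ _) hB0.ne'
    exact absurd h1 (not_le.2 h3)
  -- The null remainder is added as set number 0, so that the cover is exact.
  refine ⟨fun n => Nat.casesOn n (⋃ n, D n)ᶜ D, ?_, ?_, ?_⟩
  · intro n
    cases n with
    | zero => exact hDm.compl
    | succ n => exact hD.1 n
  · intro n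
    cases n with
    | zero => exact hnull.le.trans zero_le
    | succ n => exact hD.2 n
  · rw [Set.eq_univ_iff_forall]
    intro x
    by_cases hx : x ∈ ⋃ n, D n
    · obtain ⟨n, hn⟩ := Set.mem_iUnion.1 hx
      exact Set.mem_iUnion.2 ⟨n + 1, hn⟩
    · exact Set.mem_iUnion.2 ⟨0, hx⟩

/-- A nonatomic space carries a random variable with diffuse law. -/
theorem exists_measurable_diffuse [IsFiniteMeasure μ] (hμ : IsNonatomic μ) :
    ∃ c : Ω → ℝ, Measurable c ∧ ∀ x, μ (c ⁻¹' {x}) = 0 := by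
  choose B hB hBε hBu using fun k : ℕ =>
    hμ.exists_iUnion_eq_univ (ε := ((k : ENNReal) + 1)⁻¹) (by simp)
  -- `b ω` records which sets of all the covers contain ω. A level set of `b` lies inside a single
  -- set of the k-th cover, so its measure is at most 1/(k+1) for every k.
  let b : Ω → ℕ → ℕ → ℝ := fun ω k n => (B k n).indicator 1 ω
  have hb : Measurable b := by
    refine measurable_pi_lambda _ fun k => measurable_pi_lambda _ fun n => ?_
    exact measurable_one.indicator (hB k n)
  have he := measurableEmbedding_embeddingReal (ℕ → ℕ → ℝ)
  refine ⟨fun ω => embeddingReal _ (b ω), he.measurable.comp hb, fun x => ?_⟩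
  by_contra h0
  obtain ⟨ω₀, hω₀⟩ := nonempty_of_measure_ne_zero h0
  have hle : ∀ k : ℕ, μ ((fun ω => embeddingReal _ (b ω)) ⁻¹' {x}) ≤ ((k : ENNReal) + 1)⁻¹ := by
    intro k
    have : ω₀ ∈ ⋃ n, B k n := by rw [hBu]; trivial
    obtain ⟨n, hn⟩ := Set.mem_iUnion.1 this
    refine le_trans (measure_mono fun ω hω => ?_) (hBε k n)
    have h1 : b ω = b ω₀ := he.injective (hω.trans hω₀.symm)
    have h2 : (B k n).indicator (1 : Ω → ℝ) ω = (B k n).indicator 1 ω₀ :=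
      congrFun (congrFun h1 k) n
    rw [Set.indicator_of_mem hn] at h2
    by_contra hnot
    rw [Set.indicator_of_notMem hnot] at h2
    simp at h2
  obtain ⟨k, hk⟩ := ENNReal.exists_inv_nat_lt h0
  refine absurd ((hle k).trans ?_) (not_le.2 hk)
  exact ENNReal.inv_le_inv.2 le_self_add

end IsNonatomic

/-! ### Distribution functions and equality in law -/

/-- The distribution function of a diffuse law transforms it into the uniform law. -/
theorem exists_map_eq_volume_unitInterval (ν : Measure ℝ) [IsProbabilityMeasure ν]
    (hν : ∀ x, ν {x} = 0) :
    ∃ F : ℝ → unitInterval, Measurable F ∧ ν.map F = volume := by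
  let F : ℝ → unitInterval := fun x => ⟨cdf ν x, cdf_nonneg ν x, cdf_le_one ν x⟩
  have hmono : Monotone F := fun x y h => monotone_cdf ν h
  have hF : Measurable F := hmono.measurable
  have hcont : Continuous (cdf ν) := by
    refine continuous_iff_continuousAt.2 fun x => ?_
    rw [(monotone_cdf ν).continuousAt_iff_leftLim_eq_rightLim, StieltjesFunction.rightLim_eq]
    have h := StieltjesFunction.measure_singleton (cdf ν) x
    rw [measure_cdf, hν, eq_comm, ENNReal.ofReal_eq_zero] at h
    exact le_antisymm ((monotone_cdf ν).leftLim_le le_rfl) (by linarith)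
  refine ⟨F, hF, ?_⟩
  have : IsProbabilityMeasure (ν.map F) := Measure.isProbabilityMeasure_map hF.aemeasurable
  refine Measure.ext_of_Iic _ _ fun x => ?_
  rw [Measure.map_apply hF measurableSet_Iic, unitInterval.volume_Iic]
  -- The value 1 is treated apart because its sublevel set is everything; below 1 a nonempty
  -- sublevel set is a half-line with a largest point `y`.
  rcases eq_or_lt_of_le x.2.2 with hx1 | hx1
  · have : F ⁻¹' Set.Iic x = Set.univ := by
      ext y
      simp only [Set.mem_preimage, Set.mem_Iic, Set.mem_univ, iff_true]
      exact Subtype.coe_le_coe.1 (hx1 ▸ (F y).2.2)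
    rw [this, hx1]; simp
  by_cases hne : (F ⁻¹' Set.Iic x).Nonempty
  · have hbdd : BddAbove (F ⁻¹' Set.Iic x) := by
      obtain ⟨z, hz⟩ := ((tendsto_cdf_atTop ν).eventually (lt_mem_nhds hx1)).exists
      refine ⟨z, fun y hy => ?_⟩
      by_contra! hzy
      exact absurd (hz.trans_le (monotone_cdf ν hzy.le)) (not_lt.2 hy)
    have hclosed : IsClosed (F ⁻¹' Set.Iic x) :=
      isClosed_Iic.preimage (hcont.subtype_mk _)
    set y := sSup (F ⁻¹' Set.Iic x)
    have hy : F y ≤ x := hclosed.csSup_mem hne hbdd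
    have hIic : F ⁻¹' Set.Iic x = Set.Iic y :=
      Set.Subset.antisymm (fun z hz => le_csSup hbdd hz) fun z hz => (hmono hz).trans hy
    -- To the right of `y` the distribution function exceeds `x`, so continuity rules out a smaller
    -- value at `y`.
    have hyx : cdf ν y = x := by
      refine le_antisymm hy ?_
      refine ge_of_tendsto (x := 𝓝[>] y) (hcont.continuousWithinAt (s := Set.Ioi y)) ?_
      filter_upwards [self_mem_nhdsWithin] with z hz
      by_contra! hzx
      have : z ∈ F ⁻¹' Set.Iic x := hzx.le
      rw [hIic] at this
      exact absurd (Set.mem_Iic.1 this) (not_le.2 hz)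
    rw [hIic, ← ofReal_cdf, hyx]
  · rw [Set.not_nonempty_iff_eq_empty.1 hne]
    have h0 : (x : ℝ) ≤ 0 := by
      refine ge_of_tendsto' (tendsto_cdf_atBot ν) fun y => ?_
      by_contra! h
      exact hne ⟨y, h.le⟩
    simp [ENNReal.ofReal_eq_zero.2 h0]

theorem MeasureTheory.measure_eq_tsum_inter_preimage_singleton {Ω ι : Type*} [MeasurableSpace Ω]
    [MeasurableSpace ι] [Countable ι] [MeasurableSingletonClass ι] {μ : Measure Ω} {N : Ω → ι}
    (hN : Measurable N) {A : Set Ω} (hA : MeasurableSet A) :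
    μ A = ∑' k, μ (A ∩ N ⁻¹' {k}) := by
  rw [← measure_iUnion (fun i j hij => ?_) fun k => hA.inter (hN (measurableSet_singleton k)),
    ← Set.inter_iUnion, ← Set.preimage_iUnion, Set.iUnion_of_singleton, Set.preimage_univ,
    Set.inter_univ]
  refine Set.disjoint_left.2 fun ω h1 h2 => hij ?_
  exact (Set.mem_singleton_iff.1 h1.2).symm.trans (Set.mem_singleton_iff.1 h2.2)

/-- Indicators of random variables with the same conditional laws have the same law. -/
theorem ProbabilityTheory.identDistrib_indicator {Ω : Type*} [MeasurableSpace Ω] {μ : Measure Ω}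
    [IsFiniteMeasure μ] {f g : Ω → ℝ} (hf : Measurable f) (hg : Measurable g) {S G : Set Ω}
    (hS : MeasurableSet S) (hG : MeasurableSet G)
    (h : ∀ B, MeasurableSet B → μ (g ⁻¹' B ∩ G) = μ (f ⁻¹' B ∩ S)) :
    IdentDistrib (G.indicator g) (S.indicator f) μ μ := by
  refine ⟨(hg.indicator hG).aemeasurable, (hf.indicator hS).aemeasurable, ?_⟩
  ext B hB
  have hGS : μ G = μ S := by simpa using h Set.univ MeasurableSet.univ
  rw [Measure.map_apply (hg.indicator hG) hB, Measure.map_apply (hf.indicator hS) hB,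
    Set.indicator_preimage, Set.indicator_preimage, Set.ite, Set.ite,
    measure_union (Set.disjoint_left.2 fun ω h1 h2 => h2.2 h1.2)
      ((measurable_zero hB).diff hG),
    measure_union (Set.disjoint_left.2 fun ω h1 h2 => h2.2 h1.2)
      ((measurable_zero hB).diff hS), h B hB]
  congr 1
  by_cases h0 : (0 : ℝ) ∈ B
  · have : (0 : Ω → ℝ) ⁻¹' B = Set.univ := Set.eq_univ_of_forall fun _ => h0
    rw [this, ← Set.compl_eq_univ_sdiff, ← Set.compl_eq_univ_sdiff,
      measure_compl hG (measure_ne_top _ _), measure_compl hS (measure_ne_top _ _), hGS]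
  · have : (0 : Ω → ℝ) ⁻¹' B = ∅ := Set.eq_empty_of_forall_notMem fun _ => h0
    simp [this]

theorem ProbabilityTheory.identDistrib_indicator_one {Ω : Type*} [MeasurableSpace Ω]
    {μ : Measure Ω} [IsFiniteMeasure μ] {S G : Set Ω} (hS : MeasurableSet S)
    (hG : MeasurableSet G) (h : μ G = μ S) :
    IdentDistrib (G.indicator (1 : Ω → ℝ)) (S.indicator 1) μ μ := by
  refine identDistrib_indicator measurable_one measurable_one hS hG fun D _ => ?_
  by_cases h0 : (1 : ℝ) ∈ D
  · rw [show (1 : Ω → ℝ) ⁻¹' D = Set.univ from Set.eq_univ_of_forall fun _ => h0]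
    simp [h]
  · rw [show (1 : Ω → ℝ) ⁻¹' D = ∅ from Set.eq_empty_of_forall_notMem fun _ => h0]
    simp

/-! ### Realizing prescribed laws -/

namespace IsNonatomic

variable {Ω : Type*} [MeasurableSpace Ω] {μ : Measure Ω}
  {T : Type*} [MeasurableSpace T] [StandardBorelSpace T] [Nonempty T]

/-- Every law of the right mass is realized by a random variable on a given measurable set. -/
theorem exists_map_restrict_eq [IsFiniteMeasure μ] (hμ : IsNonatomic μ) {G : Set Ω}
    (ν : Measure T) (hν : ν Set.univ = μ G) :
    ∃ g : Ω → T, Measurable g ∧ (μ.restrict G).map g = ν := by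
  by_cases h0 : μ G = 0
  · refine ⟨fun _ => Classical.arbitrary T, measurable_const, ?_⟩
    rw [h0, Measure.measure_univ_eq_zero] at hν
    rw [hν, Measure.restrict_eq_zero.2 h0, Measure.map_zero]
  obtain ⟨c, hc, hc0⟩ := hμ.exists_measurable_diffuse
  have hG : IsProbabilityMeasure ((μ G)⁻¹ • μ.restrict G) :=
    ⟨by simp [ENNReal.inv_mul_cancel h0 (measure_ne_top μ G)]⟩
  have hp : IsProbabilityMeasure (((μ G)⁻¹ • μ.restrict G).map c) :=
    Measure.isProbabilityMeasure_map hc.aemeasurable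
  obtain ⟨F, hF, hFν⟩ := exists_map_eq_volume_unitInterval (((μ G)⁻¹ • μ.restrict G).map c) (by
    intro x
    rw [Measure.map_apply hc (measurableSet_singleton x), Measure.smul_apply,
      Measure.restrict_apply (hc (measurableSet_singleton x)),
      measure_mono_null Set.inter_subset_left (hc0 x), smul_zero])
  have hν1 : IsProbabilityMeasure ((μ G)⁻¹ • ν) :=
    ⟨by simp [hν, ENNReal.inv_mul_cancel h0 (measure_ne_top μ G)]⟩
  -- The normalized restriction to `G` carries a uniform variable `F ∘ c`, and every law on a
  -- standard Borel space is an image of the uniform law.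
  obtain ⟨φ, hφ, hφν⟩ := Measure.exists_measurable_map_eq ((μ G)⁻¹ • ν)
  refine ⟨φ ∘ F ∘ c, hφ.comp (hF.comp hc), ?_⟩
  rw [← hFν, Measure.map_map hφ hF, Measure.map_map (hφ.comp hF) hc, Measure.map_smul] at hφν
  have h := congrArg (fun m => μ G • m) hφν
  simpa only [smul_smul, ENNReal.mul_inv_cancel h0 (measure_ne_top μ G), one_smul,
    Function.comp_assoc] using h

/-- A set contains measurable subsets of any smaller measure. -/
theorem exists_subset_measure_eq [IsFiniteMeasure μ] (hμ : IsNonatomic μ) {G : Set Ω}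
    (hG : MeasurableSet G) {a : ENNReal} (ha : a ≤ μ G) :
    ∃ B, MeasurableSet B ∧ B ⊆ G ∧ μ B = a := by
  obtain ⟨g, hg, hgν⟩ := hμ.exists_map_restrict_eq (G := G)
    (a • Measure.dirac true + (μ G - a) • Measure.dirac false)
    (by simp [add_tsub_cancel_of_le ha])
  refine ⟨g ⁻¹' {true} ∩ G, (hg (measurableSet_singleton _)).inter hG, Set.inter_subset_right, ?_⟩
  rw [← Measure.restrict_apply (hg (measurableSet_singleton _)),
    ← Measure.map_apply hg (measurableSet_singleton _), hgν]
  simp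

/-- Realizing the joint law of a discrete and an arbitrary random variable with the discrete
component prescribed. -/
theorem exists_map_restrict_fiber_eq [IsFiniteMeasure μ] (hμ : IsNonatomic μ) {ι : Type*}
    [MeasurableSpace ι] [Countable ι] [MeasurableSingletonClass ι] {N N' : Ω → ι}
    (hN' : Measurable N') (hNN' : ∀ k, μ (N ⁻¹' {k}) = μ (N' ⁻¹' {k}))
    {f : Ω → T} (hf : Measurable f) :
    ∃ g : Ω → T, Measurable g ∧
      ∀ k, (μ.restrict (N' ⁻¹' {k})).map g = (μ.restrict (N ⁻¹' {k})).map f := by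
  choose g hg hgk using fun k => hμ.exists_map_restrict_eq (G := N' ⁻¹' {k})
    ((μ.restrict (N ⁻¹' {k})).map f) (by
      rw [Measure.map_apply hf MeasurableSet.univ, Set.preimage_univ, Measure.restrict_apply_univ,
        hNN'])
  refine ⟨fun ω => g (N' ω) ω, ?_, fun k => ?_⟩
  · have h : Measurable fun p : ι × Ω => g p.1 p.2 := measurable_from_prod_countable_right hg
    exact h.comp (hN'.prodMk measurable_id)
  · rw [← hgk k]
    refine Measure.map_congr ?_
    filter_upwards [ae_restrict_mem (hN' (measurableSet_singleton k))] with ω hω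
    rw [Set.mem_preimage, Set.mem_singleton_iff] at hω
    rw [hω]

/-- If `Z` has the law of `h ∘ f`, then `f` has a copy `g` with `h ∘ g` uniformly close to `Z`. -/
theorem exists_identDistrib_abs_sub_le [IsFiniteMeasure μ] (hμ : IsNonatomic μ) {f : Ω → T}
    (hf : Measurable f) {h : T → ℝ} (hh : Measurable h) {Z : Ω → ℝ} (hZ : Measurable Z)
    (hZf : IdentDistrib Z (h ∘ f) μ μ) {ε : ℝ} (hε : 0 < ε) :
    ∃ g : Ω → T, Measurable g ∧ IdentDistrib g f μ μ ∧ ∀ᵐ ω ∂μ, |h (g ω) - Z ω| ≤ ε := by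
  -- Exact equality `h ∘ g = Z` can be impossible: `Z` may generate the whole σ-algebra and leave no
  -- room for the rest of `f`. Rounding to the scale ε leaves countably many cells, on each of which
  -- the conditional law of `f` can be copied.
  let q : ℝ → ℤ := fun x => ⌊x / ε⌋
  have hq : Measurable q := Int.measurable_floor.comp (measurable_id.div_const ε)
  have hqN : ∀ k, MeasurableSet (q ⁻¹' {k}) := fun k => hq (measurableSet_singleton k)
  obtain ⟨g, hg, hgk⟩ := hμ.exists_map_restrict_fiber_eq (N := q ∘ h ∘ f) (N' := q ∘ Z)
    (hq.comp hZ) (fun k => (hZf.measure_mem_eq (hqN k)).symm) hf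
  have hm : ∀ k {B : Set T}, MeasurableSet B →
      μ (g ⁻¹' B ∩ (q ∘ Z) ⁻¹' {k}) = μ (f ⁻¹' B ∩ (q ∘ h ∘ f) ⁻¹' {k}) := by
    intro k B hB
    rw [← Measure.restrict_apply (hg hB), ← Measure.restrict_apply (hf hB),
      ← Measure.map_apply hg hB, ← Measure.map_apply hf hB, hgk]
  refine ⟨g, hg, ⟨hg.aemeasurable, hf.aemeasurable, ?_⟩, ?_⟩
  · ext B hB
    rw [Measure.map_apply hg hB, Measure.map_apply hf hB,
      measure_eq_tsum_inter_preimage_singleton (hq.comp hZ) (hg hB),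
      measure_eq_tsum_inter_preimage_singleton (hq.comp (hh.comp hf)) (hf hB)]
    exact tsum_congr fun k => hm k hB
  -- On the k-th cell of `Z`, `g` has the law of `f` on the k-th cell of `h ∘ f`, so `h ∘ g` almost
  -- surely stays in that cell.
  · have hae : ∀ k : ℤ, ∀ᵐ ω ∂μ, q (Z ω) = k → q (h (g ω)) = k := by
      intro k
      have h1 := hm k (hh (hqN k)).compl
      rw [show f ⁻¹' (h ⁻¹' (q ⁻¹' {k}))ᶜ ∩ (q ∘ h ∘ f) ⁻¹' {k} = ∅ by
        ext; simp, measure_empty] at h1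
      filter_upwards [measure_eq_zero_iff_ae_notMem.1 h1] with ω hω hk
      by_contra hne
      exact hω ⟨hne, hk⟩
    filter_upwards [ae_all_iff.2 hae] with ω hω
    have h1 := Int.abs_sub_lt_one_of_floor_eq_floor (hω (q (Z ω)) rfl)
    rw [← sub_div, abs_div, abs_of_pos hε, div_lt_one hε] at h1
    exact h1.le

end IsNonatomic

/-! ### Pointwise calculus and constants in r.i. spaces -/

namespace RISpace

variable {Ω : Type*} [MeasurableSpace Ω] {μ : Measure Ω} {E : RISpace μ}

theorem measurable_coe (X : E.space) : Measurable ((X : Ω →ₘ[μ] ℝ) : Ω → ℝ) :=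
  (X : Ω →ₘ[μ] ℝ).stronglyMeasurable.measurable

theorem coeFn_add (X Y : E.space) : ∀ᵐ ω ∂μ,
    ((X + Y : E.space) : Ω →ₘ[μ] ℝ) ω = (X : Ω →ₘ[μ] ℝ) ω + (Y : Ω →ₘ[μ] ℝ) ω :=
  AEEqFun.coeFn_add (X : Ω →ₘ[μ] ℝ) Y

theorem coeFn_sub (X Y : E.space) : ∀ᵐ ω ∂μ,
    ((X - Y : E.space) : Ω →ₘ[μ] ℝ) ω = (X : Ω →ₘ[μ] ℝ) ω - (Y : Ω →ₘ[μ] ℝ) ω :=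
  AEEqFun.coeFn_sub (X : Ω →ₘ[μ] ℝ) Y

theorem coeFn_smul (c : ℝ) (X : E.space) : ∀ᵐ ω ∂μ,
    ((c • X : E.space) : Ω →ₘ[μ] ℝ) ω = c * (X : Ω →ₘ[μ] ℝ) ω :=
  AEEqFun.coeFn_smul c (X : Ω →ₘ[μ] ℝ)

theorem coeFn_zero : ∀ᵐ ω ∂μ, ((0 : E.space) : Ω →ₘ[μ] ℝ) ω = 0 :=
  AEEqFun.coeFn_zero

theorem coeFn_sum {ι : Type*} (s : Finset ι) (X : ι → E.space) : ∀ᵐ ω ∂μ,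
    ((∑ i ∈ s, X i : E.space) : Ω →ₘ[μ] ℝ) ω = ∑ i ∈ s, (X i : Ω →ₘ[μ] ℝ) ω := by
  classical
  induction s using Finset.induction_on with
  | empty => simpa using coeFn_zero (E := E)
  | insert a s ha ih =>
    rw [Finset.sum_insert ha]
    filter_upwards [ih, coeFn_add (X a) (∑ i ∈ s, X i)] with ω h1 h2
    rw [h2, h1, Finset.sum_insert ha]

theorem coeFn_restrict (X : E.space) {A : Set Ω} (hA : MeasurableSet A) : ∀ᵐ ω ∂μ,
    (restrict X A hA : Ω →ₘ[μ] ℝ) ω = A.indicator (X : Ω →ₘ[μ] ℝ) ω :=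
  AEEqFun.coeFn_mk _ _

theorem coeFn_negPart (X : E.space) : ∀ᵐ ω ∂μ,
    (negPart X : Ω →ₘ[μ] ℝ) ω = max (-(X : Ω →ₘ[μ] ℝ) ω) 0 := by
  filter_upwards [AEEqFun.coeFn_sup (-(X : Ω →ₘ[μ] ℝ)) 0,
    AEEqFun.coeFn_neg (X : Ω →ₘ[μ] ℝ), AEEqFun.coeFn_zero (μ := μ) (β := ℝ)] with ω h1 h2 h3
  rw [negPart, h1, h2, h3, Pi.neg_apply, Pi.zero_apply]

theorem ext_ae {X Y : E.space}
    (h : ∀ᵐ ω ∂μ, (X : Ω →ₘ[μ] ℝ) ω = (Y : Ω →ₘ[μ] ℝ) ω) : X = Y :=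
  Subtype.ext (AEEqFun.ext h)

theorem norm_le_of_abs_le {X Y : E.space}
    (h : ∀ᵐ ω ∂μ, |(Y : Ω →ₘ[μ] ℝ) ω| ≤ |(X : Ω →ₘ[μ] ℝ) ω|) : ‖Y‖ ≤ ‖X‖ :=
  (E.solid X Y h).2

theorem exists_coeFn_of_abs_le (X : E.space) {f : Ω → ℝ} (hf : AEMeasurable f μ)
    (h : ∀ᵐ ω ∂μ, |f ω| ≤ |(X : Ω →ₘ[μ] ℝ) ω|) :
    ∃ Y : E.space, ∀ᵐ ω ∂μ, (Y : Ω →ₘ[μ] ℝ) ω = f ω := by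
  have hc := AEEqFun.coeFn_mk f hf.aestronglyMeasurable
  obtain ⟨hY, -⟩ := E.solid X (AEEqFun.mk f hf.aestronglyMeasurable) (by
    filter_upwards [h, hc] with ω h1 h2
    rwa [h2])
  exact ⟨⟨_, hY⟩, hc⟩

theorem SameLaw.norm_eq {X Y : E.space} (h : SameLaw X Y) : ‖X‖ = ‖Y‖ :=
  (E.rearrangement Y X h).2

theorem exists_coeFn_of_identDistrib (X : E.space) {f : Ω → ℝ}
    (h : IdentDistrib f (X : Ω →ₘ[μ] ℝ) μ μ) :
    ∃ Y : E.space, (∀ᵐ ω ∂μ, (Y : Ω →ₘ[μ] ℝ) ω = f ω) ∧ SameLaw Y X := by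
  have hc := AEEqFun.coeFn_mk f h.aemeasurable_fst.aestronglyMeasurable
  have hl : IdentDistrib (AEEqFun.mk f h.aemeasurable_fst.aestronglyMeasurable)
      (X : Ω →ₘ[μ] ℝ) μ μ :=
    (IdentDistrib.of_ae_eq (AEEqFun.aemeasurable _) hc).trans h
  obtain ⟨hY, -⟩ := E.rearrangement X _ hl
  exact ⟨⟨_, hY⟩, hc, hl⟩

/-- Over a nonatomic probability space, an r.i. space contains the constant `1`. -/
theorem exists_coeFn_eq_one [IsProbabilityMeasure μ] (hμ : IsNonatomic μ) (E : RISpace μ) :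
    ∃ I : E.space, ∀ᵐ ω ∂μ, (I : Ω →ₘ[μ] ℝ) ω = 1 := by
  obtain ⟨X, hX⟩ := E.nontrivial
  -- Since X ≠ 0, some multiple of |X| is at least 1 on a set `A` of positive measure. Solidity
  -- gives indicators of subsets of `A`, rearrangement those of all sets no larger than `A`, and
  -- finite sums reach Ω.
  obtain ⟨n, hn⟩ : ∃ n : ℕ, μ {ω | (1 : ℝ) ≤ n * |(X : Ω →ₘ[μ] ℝ) ω|} ≠ 0 := by
    by_contra! h
    refine hX (ext_ae ?_)
    have h1 : ∀ n : ℕ, ∀ᵐ ω ∂μ, ¬ (1 : ℝ) ≤ n * |(X : Ω →ₘ[μ] ℝ) ω| := fun n =>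
      measure_eq_zero_iff_ae_notMem.1 (h n)
    filter_upwards [ae_all_iff.2 h1, coeFn_zero (E := E)] with ω h2 h3
    rw [h3]
    by_contra h0
    obtain ⟨n, hn⟩ := exists_nat_ge (1 / |(X : Ω →ₘ[μ] ℝ) ω|)
    exact h2 n ((div_le_iff₀ (abs_pos.2 h0)).1 hn)
  set A := {ω | (1 : ℝ) ≤ n * |(X : Ω →ₘ[μ] ℝ) ω|} with hAdef
  have hA : MeasurableSet A :=
    measurableSet_le measurable_const (measurable_const.mul (measurable_coe X).abs)
  have hsmall : ∀ B, MeasurableSet B → μ B ≤ μ A →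
      ∃ Y : E.space, ∀ᵐ ω ∂μ, (Y : Ω →ₘ[μ] ℝ) ω = B.indicator 1 ω := by
    intro B hB hBA
    obtain ⟨C, hC, hCA, hCB⟩ := hμ.exists_subset_measure_eq hA hBA
    obtain ⟨Y, hY⟩ := exists_coeFn_of_abs_le ((n : ℝ) • X) (f := C.indicator 1)
      (measurable_one.indicator hC).aemeasurable (by
        filter_upwards [coeFn_smul (n : ℝ) X] with ω h1
        rw [h1]
        by_cases hω : ω ∈ C
        · have : (1 : ℝ) ≤ n * |(X : Ω →ₘ[μ] ℝ) ω| := hCA hω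
          simpa [hω, abs_mul] using this
        · simp only [Set.indicator_of_notMem hω, abs_zero, abs_nonneg])
    have hid : IdentDistrib (B.indicator 1) (C.indicator (1 : Ω → ℝ)) μ μ :=
      identDistrib_indicator_one hC hB hCB.symm
    obtain ⟨Z, hZ, -⟩ := exists_coeFn_of_identDistrib Y (hid.trans
      (IdentDistrib.of_ae_eq (measurable_one.indicator hC).aemeasurable
        (hY.mono fun ω h => h.symm)))
    exact ⟨Z, hZ⟩
  have hind : ∀ (k : ℕ) (B : Set Ω), MeasurableSet B → μ B ≤ k * μ A →
      ∃ Y : E.space, ∀ᵐ ω ∂μ, (Y : Ω →ₘ[μ] ℝ) ω = B.indicator 1 ω := by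
    intro k
    induction k with
    | zero => exact fun B hB h => hsmall B hB (h.trans (by simp))
    | succ k ih =>
      intro B hB h
      rcases le_total (μ B) (μ A) with hBA | hAB
      · exact hsmall B hB hBA
      obtain ⟨C, hC, hCB, hCA⟩ := hμ.exists_subset_measure_eq hB hAB
      obtain ⟨Y, hY⟩ := hsmall C hC hCA.le
      obtain ⟨Z, hZ⟩ := ih (B \ C) (hB.diff hC) (by
        rw [measure_sdiff hCB hC.nullMeasurableSet (measure_ne_top _ _), hCA, tsub_le_iff_right]
        refine h.trans (le_of_eq ?_)
        push_cast
        ring)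
      refine ⟨Y + Z, ?_⟩
      filter_upwards [hY, hZ, coeFn_add Y Z] with ω h1 h2 h3
      rw [h3, h1, h2]
      by_cases hωC : ω ∈ C
      · simp [hωC, hCB hωC]
      · by_cases hωB : ω ∈ B <;> simp [hωC, hωB]
  obtain ⟨k, hk⟩ := ENNReal.exists_nat_mul_gt hn (b := 1) (by simp)
  obtain ⟨I, hI⟩ := hind k Set.univ MeasurableSet.univ (by simpa using hk.le)
  exact ⟨I, by simpa using hI⟩

/-! ### The order continuous part -/

section OrderContinuousPart

theorem zero_mem_orderContinuousPart : (0 : E.space) ∈ E.orderContinuousPart := by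
  intro ε hε
  refine ⟨1, one_pos, fun A hA _ => ?_⟩
  rw [show restrict (0 : E.space) A hA = 0 from ext_ae (by
    filter_upwards [coeFn_restrict (0 : E.space) hA, coeFn_zero (E := E)] with ω h1 h2
    rw [h1, h2]
    exact Set.indicator_apply_eq_zero.2 fun _ => h2), norm_zero]
  exact hε

theorem restrict_add (X Y : E.space) {A : Set Ω} (hA : MeasurableSet A) :
    restrict (X + Y) A hA = restrict X A hA + restrict Y A hA := by
  refine ext_ae ?_
  filter_upwards [coeFn_restrict (X + Y) hA, coeFn_restrict X hA, coeFn_restrict Y hA,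
    coeFn_add X Y, coeFn_add (restrict X A hA) (restrict Y A hA)] with ω h1 h2 h3 h4 h5
  rw [h5, h1, h2, h3]
  by_cases hω : ω ∈ A
  · simp only [Set.indicator_of_mem hω, h4]
  · simp only [Set.indicator_of_notMem hω, add_zero]

theorem restrict_smul (c : ℝ) (X : E.space) {A : Set Ω} (hA : MeasurableSet A) :
    restrict (c • X) A hA = c • restrict X A hA := by
  refine ext_ae ?_
  filter_upwards [coeFn_restrict (c • X) hA, coeFn_restrict X hA, coeFn_smul c X,
    coeFn_smul c (restrict X A hA)] with ω h1 h2 h3 h4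
  rw [h4, h1, h2]
  by_cases hω : ω ∈ A
  · simp only [Set.indicator_of_mem hω, h3]
  · simp only [Set.indicator_of_notMem hω, mul_zero]

theorem norm_restrict_le (X : E.space) {A : Set Ω} (hA : MeasurableSet A) :
    ‖restrict X A hA‖ ≤ ‖X‖ := by
  refine norm_le_of_abs_le ?_
  filter_upwards [coeFn_restrict X hA] with ω h1
  rw [h1]
  by_cases hω : ω ∈ A <;> simp [hω]

theorem add_mem_orderContinuousPart {X Y : E.space} (hX : X ∈ E.orderContinuousPart)
    (hY : Y ∈ E.orderContinuousPart) : X + Y ∈ E.orderContinuousPart := by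
  intro ε hε
  obtain ⟨δ, hδ, h⟩ := hX (ε / 2) (half_pos hε)
  obtain ⟨δ', hδ', h'⟩ := hY (ε / 2) (half_pos hε)
  refine ⟨min δ δ', lt_min hδ hδ', fun A hA hAδ => ?_⟩
  rw [restrict_add]
  refine (norm_add_le _ _).trans_lt ?_
  have h1 := h A hA (hAδ.trans_le (ENNReal.ofReal_le_ofReal (min_le_left _ _)))
  have h2 := h' A hA (hAδ.trans_le (ENNReal.ofReal_le_ofReal (min_le_right _ _)))
  linarith

theorem smul_mem_orderContinuousPart (c : ℝ) {X : E.space} (hX : X ∈ E.orderContinuousPart) :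
    c • X ∈ E.orderContinuousPart := by
  intro ε hε
  obtain ⟨δ, hδ, h⟩ := hX (ε / (|c| + 1)) (by positivity)
  refine ⟨δ, hδ, fun A hA hAδ => ?_⟩
  rw [restrict_smul, norm_smul, Real.norm_eq_abs]
  have h1 := h A hA hAδ
  rw [lt_div_iff₀ (by positivity)] at h1
  nlinarith [norm_nonneg (restrict X A hA)]

theorem mem_orderContinuousPart_of_abs_le {X Y : E.space} (hX : X ∈ E.orderContinuousPart)
    (h : ∀ᵐ ω ∂μ, |(Y : Ω →ₘ[μ] ℝ) ω| ≤ |(X : Ω →ₘ[μ] ℝ) ω|) :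
    Y ∈ E.orderContinuousPart := by
  intro ε hε
  obtain ⟨δ, hδ, h'⟩ := hX ε hε
  refine ⟨δ, hδ, fun A hA hAδ => (norm_le_of_abs_le ?_).trans_lt (h' A hA hAδ)⟩
  filter_upwards [h, coeFn_restrict X hA, coeFn_restrict Y hA] with ω h1 h2 h3
  rw [h2, h3]
  by_cases hω : ω ∈ A <;> simp [hω, h1]

variable (E) in
/-- The order continuous part as a linear subspace. -/
def orderContinuousSubmodule : Submodule ℝ E.space where
  carrier := E.orderContinuousPart
  add_mem' := add_mem_orderContinuousPart
  zero_mem' := zero_mem_orderContinuousPart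
  smul_mem' c _ hX := smul_mem_orderContinuousPart c hX

/-- If `E` is not `L^∞`, then constants have order continuous norm. -/
theorem one_mem_orderContinuousPart [IsProbabilityMeasure μ] (hμ : IsNonatomic μ)
    (hE : (E.space : Set (Ω →ₘ[μ] ℝ)) ≠ (Lp ℝ ⊤ μ : Set (Ω →ₘ[μ] ℝ)))
    {I : E.space} (hI : ∀ᵐ ω ∂μ, (I : Ω →ₘ[μ] ℝ) ω = 1) : I ∈ E.orderContinuousPart := by
  by_contra hnot
  simp only [orderContinuousPart, Set.mem_ofPred_eq, not_forall, not_exists, not_and, not_lt]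
    at hnot
  obtain ⟨η, hη, hAη⟩ := hnot
  have hcoe : ∀ {A : Set Ω} (hA : MeasurableSet A), ∀ᵐ ω ∂μ,
      (restrict I A hA : Ω →ₘ[μ] ℝ) ω = A.indicator 1 ω := by
    intro A hA
    filter_upwards [hI, coeFn_restrict I hA] with ω h1 h2
    rw [h2]
    by_cases hω : ω ∈ A <;> simp [hω, h1]
  -- The norm of an indicator depends only on the measure of the set, so an arbitrarily small bad
  -- set `B` can be moved into `A`.
  have hlow : ∀ (A : Set Ω) (hA : MeasurableSet A), μ A ≠ 0 → η ≤ ‖restrict I A hA‖ := by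
    intro A hA hA0
    obtain ⟨B, hB, hBA, hBη⟩ := hAη (μ A).toReal (ENNReal.toReal_pos hA0 (measure_ne_top _ _))
    rw [ENNReal.ofReal_toReal (measure_ne_top _ _)] at hBA
    obtain ⟨C, hC, hCA, hCB⟩ := hμ.exists_subset_measure_eq hA hBA.le
    have hid : IdentDistrib (B.indicator 1) (C.indicator (1 : Ω → ℝ)) μ μ :=
      identDistrib_indicator_one hC hB hCB.symm
    have hBC : SameLaw (restrict I B hB) (restrict I C hC) :=
      ((IdentDistrib.of_ae_eq (measurable_coe _).aemeasurable (hcoe hB)).trans hid).trans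
        (IdentDistrib.of_ae_eq (measurable_coe _).aemeasurable (hcoe hC)).symm
    rw [hBC.norm_eq] at hBη
    refine hBη.trans (norm_le_of_abs_le ?_)
    filter_upwards [hcoe hA, hcoe hC] with ω h1 h2
    rw [h1, h2]
    by_cases hω : ω ∈ C
    · simp [hω, hCA hω]
    · simp [hω]
  refine hE (Set.Subset.antisymm (fun Y hY => ?_) fun Y hY => ?_)
  · let Y' : E.space := ⟨Y, hY⟩
    -- If |Y| exceeded ‖Y‖/η + 1 with positive probability, then ‖Y‖ ≥ (‖Y‖/η + 1)η = ‖Y‖ + η.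
    have hbd : ∀ᵐ ω ∂μ, ‖Y ω‖ ≤ ‖Y'‖ / η + 1 := by
      let A := {ω | ‖Y'‖ / η + 1 < |(Y' : Ω →ₘ[μ] ℝ) ω|}
      have hA : MeasurableSet A := measurableSet_lt measurable_const (measurable_coe Y').abs
      have hA0 : μ A = 0 := by
        by_contra h0
        have h1 : ‖(‖Y'‖ / η + 1) • restrict I A hA‖ ≤ ‖Y'‖ := by
          refine norm_le_of_abs_le ?_
          filter_upwards [hcoe hA, coeFn_smul (‖Y'‖ / η + 1) (restrict I A hA)] with ω h1 h2
          rw [h2, h1]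
          by_cases hω : ω ∈ A
          · have : ‖Y'‖ / η + 1 < |(Y' : Ω →ₘ[μ] ℝ) ω| := hω
            rw [Set.indicator_of_mem hω, Pi.one_apply, mul_one,
              abs_of_nonneg (by positivity)]
            exact this.le
          · simp [hω]
        rw [norm_smul, Real.norm_of_nonneg (by positivity)] at h1
        have h2 := mul_le_mul_of_nonneg_left (hlow A hA h0)
          (show 0 ≤ ‖Y'‖ / η + 1 by positivity)
        have h3 : (‖Y'‖ / η + 1) * η = ‖Y'‖ + η := by field_simp
        linarith
      filter_upwards [measure_eq_zero_iff_ae_notMem.1 hA0] with ω hω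
      exact not_lt.1 hω
    exact Lp.mem_Lp_iff_memLp.2 (memLp_top_of_bound Y.aestronglyMeasurable _ hbd)
  · have hY' := Lp.mem_Lp_iff_memLp.1 hY
    obtain ⟨Z, hZ⟩ := exists_coeFn_of_abs_le ((eLpNormEssSup Y μ).toReal • I)
      (f := Y) Y.aemeasurable (by
        filter_upwards [coeFn_smul (eLpNormEssSup Y μ).toReal I, hI,
          ae_le_eLpNormEssSup (f := Y) (μ := μ)] with ω h1 h2 h3
        rw [h1, h2, mul_one, abs_of_nonneg ENNReal.toReal_nonneg, ← Real.norm_eq_abs,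
          ← toReal_enorm]
        refine ENNReal.toReal_mono ?_ h3
        have := hY'.2
        rw [eLpNorm_exponent_top] at this
        exact this.ne)
    have : Y = Z := AEEqFun.ext (hZ.mono fun ω h => h.symm)
    rw [this]
    exact Z.2

end OrderContinuousPart

/-! ### Automatic continuity of convex decreasing functionals -/

section Continuity

theorem exists_tendsto_of_norm_sub_le_geometric {u : ℕ → E.space}
    (hu : ∀ n, ‖u (n + 1) - u n‖ ≤ (1 / 2) ^ n) :
    ∃ X, Tendsto (fun n => ‖u n - X‖) atTop (𝓝 0) := by
  have hC : CauchySeq u := by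
    refine cauchySeq_of_le_geometric (1 / 2) 1 (by norm_num) fun n => ?_
    rw [dist_comm, dist_eq_norm, one_mul]
    exact hu n
  refine E.complete u fun ε hε => ?_
  obtain ⟨N, hN⟩ := Metric.cauchySeq_iff.1 hC ε hε
  exact ⟨N, fun m hm n hn => by simpa only [dist_eq_norm] using! hN m hm n hn⟩

/-- The positive cone is closed: (X - W)⁻ ≤ |u n - X| as soon as W ≤ u n, so its norm vanishes. -/
theorem ae_le_of_tendsto {u : ℕ → E.space} {X W : E.space}
    (hu : Tendsto (fun n => ‖u n - X‖) atTop (𝓝 0))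
    (hW : ∀ᶠ n in atTop, ∀ᵐ ω ∂μ, (W : Ω →ₘ[μ] ℝ) ω ≤ (u n : Ω →ₘ[μ] ℝ) ω) :
    ∀ᵐ ω ∂μ, (W : Ω →ₘ[μ] ℝ) ω ≤ (X : Ω →ₘ[μ] ℝ) ω := by
  have h0 : ‖negPart (X - W)‖ ≤ 0 := by
    refine ge_of_tendsto hu ?_
    filter_upwards [hW] with n hn
    refine norm_le_of_abs_le ?_
    filter_upwards [hn, coeFn_negPart (X - W), coeFn_sub X W, coeFn_sub (u n) X]
      with ω h1 h2 h3 h4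
    rw [h2, h3, h4, abs_of_nonneg (le_max_right _ _)]
    refine max_le ((le_trans ?_ (le_abs_self _))) (abs_nonneg _)
    linarith
  have h1 : negPart (X - W) = 0 := norm_eq_zero.1 (le_antisymm h0 (norm_nonneg _))
  have h2 := coeFn_negPart (X - W)
  rw [h1] at h2
  filter_upwards [h2, coeFn_sub X W, coeFn_zero (E := E)] with ω h3 h4 h5
  rw [h5, h4] at h3
  have := le_max_left (-((X : Ω →ₘ[μ] ℝ) ω - (W : Ω →ₘ[μ] ℝ) ω)) 0
  linarith

/-- Finite-valued decreasing convex functionals are continuous along positive perturbations. -/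
theorem exists_sub_le_of_convexOn {ρ : E.space → ℝ} (hconv : ConvexOn ℝ Set.univ ρ)
    (hdec : IsDecreasing ρ) (X : E.space) {δ : ℝ} (hδ : 0 < δ) :
    ∃ η : ℝ, 0 < η ∧ ∀ R : E.space, (∀ᵐ ω ∂μ, 0 ≤ (R : Ω →ₘ[μ] ℝ) ω) → ‖R‖ < η →
      ρ X - δ ≤ ρ (X + R) := by
  by_contra! hcon
  -- The divisor n + 1 compensates the weight n below, so that the sum `S` of all `n • R n`
  -- converges; it dominates every single term.
  choose R hR0 hRn hRρ using fun n : ℕ => hcon ((1 / 2) ^ n / (n + 1)) (by positivity)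
  let u : ℕ → E.space := fun n => ∑ k ∈ Finset.range n, (k : ℝ) • R k
  obtain ⟨S, hS⟩ := exists_tendsto_of_norm_sub_le_geometric (u := u) fun n => by
    simp only [u, Finset.sum_range_succ, add_sub_cancel_left]
    rw [norm_smul, Real.norm_of_nonneg (Nat.cast_nonneg n)]
    have h1 := hRn n
    rw [lt_div_iff₀ (by positivity)] at h1
    nlinarith [norm_nonneg (R n)]
  have hle : ∀ n : ℕ, ∀ᵐ ω ∂μ, (((n : ℝ) • R n : E.space) : Ω →ₘ[μ] ℝ) ω
      ≤ (S : Ω →ₘ[μ] ℝ) ω := by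
    intro n
    refine ae_le_of_tendsto hS ?_
    filter_upwards [eventually_gt_atTop n] with m hm
    filter_upwards [coeFn_sum (Finset.range m) fun k => (k : ℝ) • R k, ae_all_iff.2 hR0,
      ae_all_iff.2 fun k : ℕ => coeFn_smul (k : ℝ) (R k)] with ω h1 h2 h3
    rw [h1]
    refine Finset.single_le_sum (f := fun k : ℕ => (((k : ℝ) • R k : E.space) : Ω →ₘ[μ] ℝ) ω)
      (fun k _ => ?_) (Finset.mem_range.2 hm)
    rw [h3]
    exact mul_nonneg (Nat.cast_nonneg k) (h2 k)
  have hgrow : ∀ n : ℕ, n * δ ≤ ρ (X - S) - ρ X := by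
    intro n
    have h1 : ρ (X - (n : ℝ) • R n) ≤ ρ (X - S) := by
      refine hdec _ _ (AEEqFun.coeFn_le.1 ?_)
      filter_upwards [hle n, coeFn_sub X S, coeFn_sub X ((n : ℝ) • R n)] with ω h1 h2 h3
      rw [h2, h3]
      linarith
    have hn : (0 : ℝ) < n + 1 := by positivity
    -- X is the average of X + R_n and X - n R_n with weights n : 1. A loss of δ at the first point
    -- forces a gain of nδ at the second, which ρ(X - S) cannot bound for all n.
    have h2 := hconv.2 (Set.mem_univ (X + R n)) (Set.mem_univ (X - (n : ℝ) • R n))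
      (show (0 : ℝ) ≤ n / (n + 1) by positivity) (show (0 : ℝ) ≤ 1 / (n + 1) by positivity)
      (by field_simp)
    have h3 : ((n : ℝ) / (n + 1)) • (X + R n) + ((1 : ℝ) / (n + 1)) • (X - (n : ℝ) • R n) = X := by
      match_scalars <;> field_simp
      ring
    rw [h3, smul_eq_mul, smul_eq_mul, div_mul_eq_mul_div, div_mul_eq_mul_div, ← add_div,
      le_div_iff₀ hn] at h2
    have h4 := mul_le_mul_of_nonneg_left (hRρ n).le (Nat.cast_nonneg (α := ℝ) n)
    nlinarith
  obtain ⟨n, hn⟩ := exists_nat_gt ((ρ (X - S) - ρ X) / δ)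
  rw [div_lt_iff₀ hδ] at hn
  exact absurd (hgrow n) (not_le.2 hn)

end Continuity

/-! ### Rearranging the large values -/

section Rearrangement

variable [IsProbabilityMeasure μ]

theorem tendsto_measure_coeFn_gt_atTop (X : E.space) :
    Tendsto (fun t : ℝ => μ {ω | t < (X : Ω →ₘ[μ] ℝ) ω}) atTop (𝓝 0) := by
  have hX := measurable_coe X
  have h1 : Tendsto (fun t : ℝ => μ ((X : Ω →ₘ[μ] ℝ) ⁻¹' Set.Iic t)) atTop (𝓝 1) := by
    have h := tendsto_measure_Iic_atTop (μ.map (X : Ω →ₘ[μ] ℝ))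
    rw [Measure.map_apply hX MeasurableSet.univ, Set.preimage_univ, measure_univ] at h
    simpa only [Measure.map_apply hX measurableSet_Iic] using h
  have h2 : ∀ t : ℝ, μ {ω | t < (X : Ω →ₘ[μ] ℝ) ω} = 1 - μ ((X : Ω →ₘ[μ] ℝ) ⁻¹' Set.Iic t) := by
    intro t
    rw [← prob_compl_eq_one_sub (hX measurableSet_Iic)]
    congr 1
    ext ω
    simp
  simp_rw [h2]
  simpa using ENNReal.Tendsto.sub (tendsto_const_nhds (x := (1 : ENNReal))) h1
    (Or.inl ENNReal.one_ne_top)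

/-- A rearrangement which moves the values of `Y` on `A` to the equally large set `B` in a
prescribed way. -/
theorem exists_sameLaw_swap (hμ : IsNonatomic μ) (Y : E.space) {A B : Set Ω}
    (hA : MeasurableSet A) (hB : MeasurableSet B) (hAB : Disjoint A B) {z : Ω → ℝ}
    (hz : Measurable z)
    (hzY : ∀ D, MeasurableSet D → μ (z ⁻¹' D ∩ B) = μ ((Y : Ω →ₘ[μ] ℝ) ⁻¹' D ∩ A)) {s : ℝ}
    (hs : ∀ᵐ ω ∂μ, ω ∈ B → (Y : Ω →ₘ[μ] ℝ) ω ≤ s) :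
    ∃ W : E.space, SameLaw W Y ∧ ∀ᵐ ω ∂μ, (ω ∈ A → (W : Ω →ₘ[μ] ℝ) ω ≤ s) ∧
      (ω ∈ B → (W : Ω →ₘ[μ] ℝ) ω = z ω) ∧
      (ω ∉ A → ω ∉ B → (W : Ω →ₘ[μ] ℝ) ω = (Y : Ω →ₘ[μ] ℝ) ω) := by
  classical
  have hY := measurable_coe Y
  have hAB' : ∀ ω, ω ∈ A → ω ∉ B := fun ω h1 h2 => Set.disjoint_left.1 hAB h1 h2
  -- `g` brings to `A` the values that `Y` had on `B`, in exchange for `z` on `B`.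
  obtain ⟨g, hg, hgY⟩ := hμ.exists_map_restrict_eq (G := A)
    ((μ.restrict B).map (Y : Ω →ₘ[μ] ℝ)) (by
      rw [Measure.map_apply hY MeasurableSet.univ, Set.preimage_univ, Measure.restrict_apply_univ]
      simpa using hzY Set.univ MeasurableSet.univ)
  have hgD : ∀ D, MeasurableSet D → μ (g ⁻¹' D ∩ A) = μ ((Y : Ω →ₘ[μ] ℝ) ⁻¹' D ∩ B) := by
    intro D hD
    rw [← Measure.restrict_apply (hg hD), ← Measure.restrict_apply (hY hD),
      ← Measure.map_apply hg hD, ← Measure.map_apply hY hD, hgY]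
  let w : Ω → ℝ := A.piecewise g (B.piecewise z (Y : Ω →ₘ[μ] ℝ))
  have hw : Measurable w := hg.piecewise hA (hz.piecewise hB hY)
  have hsplit : ∀ f : Ω → ℝ, Measurable f → ∀ D, MeasurableSet D → μ (f ⁻¹' D) =
      μ (f ⁻¹' D ∩ A) + (μ (f ⁻¹' D ∩ B) + μ (f ⁻¹' D ∩ (A ∪ B)ᶜ)) := by
    intro f hf D hD
    rw [← measure_inter_add_sdiff (f ⁻¹' D) hA, ← measure_inter_add_sdiff (f ⁻¹' D \ A) hB]
    congr 3
    · ext ω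
      simp only [Set.mem_inter_iff, Set.mem_sdiff]
      exact ⟨fun h => ⟨h.1.1, h.2⟩, fun h => ⟨⟨h.1, fun h' => hAB' ω h' h.2⟩, h.2⟩⟩
    · ext ω
      simp only [Set.mem_inter_iff, Set.mem_sdiff, Set.mem_compl_iff, Set.mem_union, not_or]
      tauto
  have hwY : IdentDistrib w (Y : Ω →ₘ[μ] ℝ) μ μ := by
    refine ⟨hw.aemeasurable, hY.aemeasurable, ?_⟩
    ext D hD
    rw [Measure.map_apply hw hD, Measure.map_apply hY hD, hsplit w hw D hD, hsplit _ hY D hD]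
    have h1 : w ⁻¹' D ∩ A = g ⁻¹' D ∩ A := by
      ext ω
      by_cases hω : ω ∈ A <;> simp [w, hω]
    have h2 : w ⁻¹' D ∩ B = z ⁻¹' D ∩ B := by
      ext ω
      by_cases hω : ω ∈ B
      · have : ω ∉ A := fun h => hAB' ω h hω
        simp [w, hω, this]
      · simp [hω]
    have h3 : w ⁻¹' D ∩ (A ∪ B)ᶜ = (Y : Ω →ₘ[μ] ℝ) ⁻¹' D ∩ (A ∪ B)ᶜ := by
      ext ω
      by_cases hωA : ω ∈ A
      · simp [hωA]
      · by_cases hωB : ω ∈ B <;> simp [w, hωA, hωB]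
    rw [h1, h2, h3, hgD D hD, hzY D hD]
    ring
  obtain ⟨W, hW, hWY⟩ := exists_coeFn_of_identDistrib Y hwY
  have hgs : ∀ᵐ ω ∂μ, ω ∈ A → g ω ≤ s := by
    have h1 := hgD (Set.Ioi s) measurableSet_Ioi
    have h2 : μ ((Y : Ω →ₘ[μ] ℝ) ⁻¹' Set.Ioi s ∩ B) = 0 := by
      refine measure_eq_zero_iff_ae_notMem.2 ?_
      filter_upwards [hs] with ω h ⟨h3, h4⟩
      exact absurd (h h4) (not_le.2 h3)
    rw [h2] at h1
    filter_upwards [measure_eq_zero_iff_ae_notMem.1 h1] with ω h hω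
    by_contra! hlt
    exact h ⟨hlt, hω⟩
  refine ⟨W, hWY, ?_⟩
  filter_upwards [hW, hgs] with ω h1 h2
  rw [h1]
  refine ⟨fun h => ?_, fun h => ?_, fun h h' => ?_⟩
  · simpa [w, h] using h2 h
  · have : ω ∉ A := fun h' => hAB' ω h' h
    simp [w, h, this]
  · simp [w, h, h']

/-- If `U` is close to `X` on a large set and `U, X` are dominated by `X₀`, then an average of
rearrangements of some `Y ≥ U` exceeds `X` only by terms controlled by the tails of an
equidistributional average of `X₀`. -/
theorem exists_sum_sameLaw_le (hμ : IsNonatomic μ) {I X U X₀ : E.space}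
    (hI : ∀ᵐ ω ∂μ, (I : Ω →ₘ[μ] ℝ) ω = 1)
    (hX : ∀ᵐ ω ∂μ, |(X : Ω →ₘ[μ] ℝ) ω| ≤ (X₀ : Ω →ₘ[μ] ℝ) ω)
    (hU : ∀ᵐ ω ∂μ, |(U : Ω →ₘ[μ] ℝ) ω| ≤ (X₀ : Ω →ₘ[μ] ℝ) ω)
    {ι : Type*} [Fintype ι] {l : ι → ℝ} {Z : ι → E.space} (hl0 : ∀ i, 0 ≤ l i)
    (hl1 : ∑ i, l i = 1) (hZ : ∀ i, SameLaw (Z i) X₀) {s t ε : ℝ} (hs : 0 ≤ s) (hst : s ≤ t)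
    (hε : 0 ≤ ε) {A D S : Set Ω} (hA : MeasurableSet A) (hD : MeasurableSet D)
    (hS : MeasurableSet S) (hAt : A = {ω | t < (X₀ : Ω →ₘ[μ] ℝ) ω})
    (hDε : D = {ω | ε ≤ |(U : Ω →ₘ[μ] ℝ) ω - (X : Ω →ₘ[μ] ℝ) ω|})
    (hSt : S = {ω | ∃ i, t < (Z i : Ω →ₘ[μ] ℝ) ω})
    (hSs : μ S ≤ μ {ω | (X₀ : Ω →ₘ[μ] ℝ) ω ≤ s}) :
    ∃ (Y : E.space) (W : ι → E.space) (R : E.space) (B : Set Ω) (hB : MeasurableSet B),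
      (U : Ω →ₘ[μ] ℝ) ≤ Y ∧ (∀ i, SameLaw (W i) Y) ∧
      ((∑ i, l i • W i : E.space) : Ω →ₘ[μ] ℝ) ≤ (X + R : E.space) ∧
      (∀ᵐ ω ∂μ, 0 ≤ (R : Ω →ₘ[μ] ℝ) ω) ∧ μ B ≤ μ A + μ S ∧
      ‖R‖ ≤ ε * ‖I‖ + 2 * t * ‖restrict I D hD‖ + ‖restrict (∑ i, l i • Z i) S hS‖ +
        s * ‖restrict I A hA‖ + ‖restrict (negPart X) B hB‖ := by
  have hX₀m := measurable_coe X₀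
  have hUm := measurable_coe U
  have ht : 0 ≤ t := hs.trans hst
  -- `G` receives the large values: it has the size of `S`, and X₀ ≤ s ≤ t makes it disjoint from
  -- `A`.
  obtain ⟨G, hG, hGs, hGS⟩ :=
    hμ.exists_subset_measure_eq (measurableSet_le hX₀m measurable_const) hSs
  have hGA : ∀ ω ∈ G, ω ∉ A := by
    intro ω hω hωA
    have h1 : (X₀ : Ω →ₘ[μ] ℝ) ω ≤ s := hGs hω
    have h2 : t < (X₀ : Ω →ₘ[μ] ℝ) ω := by rw [hAt] at hωA; exact hωA
    linarith
  have hfm : Measurable fun ω (i : ι) => (Z i : Ω →ₘ[μ] ℝ) ω :=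
    measurable_pi_lambda _ fun i => measurable_coe (Z i)
  -- The joint law of all `Z i` on `S` is copied, so that the weighted sums on `G` and on `S` have
  -- the same law and hence the same norm.
  obtain ⟨g, hg, hgZ⟩ := hμ.exists_map_restrict_eq (G := G)
    ((μ.restrict S).map fun ω (i : ι) => (Z i : Ω →ₘ[μ] ℝ) ω) (by
      rw [Measure.map_apply hfm MeasurableSet.univ, Set.preimage_univ,
        Measure.restrict_apply_univ, hGS])
  have hgD : ∀ C, MeasurableSet C →
      μ (g ⁻¹' C ∩ G) = μ ((fun ω (i : ι) => (Z i : Ω →ₘ[μ] ℝ) ω) ⁻¹' C ∩ S) := by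
    intro C hC
    rw [← Measure.restrict_apply (hg hC), ← Measure.restrict_apply (hfm hC),
      ← Measure.map_apply hg hC, ← Measure.map_apply hfm hC, hgZ]
  have hgi : ∀ i, Measurable fun ω => g ω i := fun i => (measurable_pi_apply i).comp hg
  have hgDi : ∀ i C, MeasurableSet C → μ ((fun ω => g ω i) ⁻¹' C ∩ G) =
      μ ((Z i : Ω →ₘ[μ] ℝ) ⁻¹' C ∩ S) := fun i C hC =>
    hgD ((fun x : ι → ℝ => x i) ⁻¹' C) (measurable_pi_apply i hC)
  have hX₀0 : ∀ᵐ ω ∂μ, 0 ≤ (X₀ : Ω →ₘ[μ] ℝ) ω := by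
    filter_upwards [hX] with ω h
    exact (abs_nonneg _).trans h
  have hg0 : ∀ᵐ ω ∂μ, ω ∈ G → ∀ i, 0 ≤ g ω i := by
    have : ∀ i, ∀ᵐ ω ∂μ, ω ∈ G → 0 ≤ g ω i := by
      intro i
      have h1 := hgDi i (Set.Iio 0) measurableSet_Iio
      have h2 : μ ((Z i : Ω →ₘ[μ] ℝ) ⁻¹' Set.Iio 0) = 0 := by
        rw [(hZ i).measure_mem_eq measurableSet_Iio]
        refine measure_eq_zero_iff_ae_notMem.2 ?_
        filter_upwards [hX₀0] with ω h h'
        exact absurd h (not_le.2 h')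
      rw [measure_mono_null Set.inter_subset_left h2] at h1
      filter_upwards [measure_eq_zero_iff_ae_notMem.1 h1] with ω h hω
      by_contra! hlt
      exact h ⟨hlt, hω⟩
    filter_upwards [ae_all_iff.2 this] with ω h hω i
    exact h i hω
  -- the majorant of `U` to be rearranged
  obtain ⟨Y, hY⟩ := exists_coeFn_of_abs_le X₀
    (f := fun ω => A.indicator (X₀ : Ω →ₘ[μ] ℝ) ω + Aᶜ.indicator (U : Ω →ₘ[μ] ℝ) ω)
    ((hX₀m.indicator hA).add (hUm.indicator hA.compl)).aemeasurable (by
      filter_upwards [hU, hX₀0] with ω h1 h2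
      by_cases hω : ω ∈ A
      · simp [hω]
      · simpa [hω, abs_of_nonneg h2] using h1)
  have hYA : ∀ᵐ ω ∂μ, ω ∈ A → (Y : Ω →ₘ[μ] ℝ) ω = (X₀ : Ω →ₘ[μ] ℝ) ω := by
    filter_upwards [hY] with ω h hω
    simp [h, hω]
  have hYU : ∀ᵐ ω ∂μ, ω ∉ A → (Y : Ω →ₘ[μ] ℝ) ω = (U : Ω →ₘ[μ] ℝ) ω := by
    filter_upwards [hY] with ω h hω
    simp [h, hω]
  have hBm : ∀ i, MeasurableSet (G ∩ {ω | t < g ω i}) := fun i =>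
    hG.inter (measurableSet_lt measurable_const (hgi i))
  -- `W i` exchanges `A` with the part of `G` where g_i > t. The laws match because {Z_i > t} ⊆ S,
  -- Z_i ∼ X₀ and Y = X₀ on A.
  choose W hWY hW using fun i => exists_sameLaw_swap hμ Y hA (hBm i)
    (Set.disjoint_left.2 fun ω h1 h2 => hGA ω h2.1 h1) (hgi i) (fun C hC => by
      have h1 := hgDi i (C ∩ Set.Ioi t) (hC.inter measurableSet_Ioi)
      have h2 := (hZ i).measure_mem_eq (hC.inter (measurableSet_Ioi (a := t)))
      have h3 : (Z i : Ω →ₘ[μ] ℝ) ⁻¹' (C ∩ Set.Ioi t) ∩ S =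
          (Z i : Ω →ₘ[μ] ℝ) ⁻¹' (C ∩ Set.Ioi t) := by
        refine Set.inter_eq_left.2 fun ω hω => ?_
        rw [hSt]
        exact ⟨i, hω.2⟩
      rw [h3, h2] at h1
      have h4 : (fun ω => g ω i) ⁻¹' C ∩ (G ∩ {ω | t < g ω i}) =
          (fun ω => g ω i) ⁻¹' (C ∩ Set.Ioi t) ∩ G := by
        ext ω
        simp only [Set.mem_inter_iff, Set.mem_preimage, Set.mem_ofPred_eq, Set.mem_Ioi]
        tauto
      rw [h4, h1]
      refine measure_congr (eventuallyEq_set.2 ?_)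
      filter_upwards [hYA] with ω h
      simp only [Set.mem_inter_iff, Set.mem_preimage, Set.mem_Ioi]
      constructor
      · rintro ⟨h5, h6⟩
        have h7 : ω ∈ A := by rw [hAt]; exact h6
        exact ⟨by rwa [h h7], h7⟩
      · rintro ⟨h5, h6⟩
        exact ⟨by rwa [← h h6], by rw [hAt] at h6; exact h6⟩) (s := s) (by
      filter_upwards [hYU, hU] with ω h1 h2 h3
      rw [h1 (hGA ω h3.1)]
      exact (le_abs_self _).trans (h2.trans (hGs h3.1)))
  have hQm : Measurable fun ω => ∑ i, l i * g ω i :=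
    Finset.measurable_sum _ fun i _ => (hgi i).const_mul (l i)
  have hQid : IdentDistrib (G.indicator fun ω => ∑ i, l i * g ω i)
      (restrict (∑ i, l i • Z i) S hS : Ω →ₘ[μ] ℝ) μ μ := by
    have hm : Measurable fun ω => ∑ i, l i * (Z i : Ω →ₘ[μ] ℝ) ω :=
      Finset.measurable_sum _ fun i _ => (measurable_coe (Z i)).const_mul (l i)
    refine (identDistrib_indicator hm hQm hS hG fun C hC =>
      hgD ((fun x : ι → ℝ => ∑ i, l i * x i) ⁻¹' C) ?_).trans
      (IdentDistrib.of_ae_eq (hm.indicator hS).aemeasurable ?_)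
    · exact Finset.measurable_sum Finset.univ (f := fun i (x : ι → ℝ) => l i * x i)
        (fun i _ => by fun_prop) hC
    · filter_upwards [coeFn_restrict (∑ i, l i • Z i) hS,
        coeFn_sum Finset.univ fun i => l i • Z i,
        ae_all_iff.2 fun i => coeFn_smul (l i) (Z i)] with ω h1 h2 h3
      rw [h1]
      by_cases hω : ω ∈ S
      · rw [Set.indicator_of_mem hω, Set.indicator_of_mem hω, h2]
        exact Finset.sum_congr rfl fun i _ => (h3 i).symm
      · rw [Set.indicator_of_notMem hω, Set.indicator_of_notMem hω]
  obtain ⟨Q, hQ, hQl⟩ := exists_coeFn_of_identDistrib _ hQid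
  have hAG : MeasurableSet (A ∪ G) := hA.union hG
  -- The terms bound, in order: U - X off `D`; U - X on `D` but off `A`, where both variables are at
  -- most t in modulus; the large values moved to `G`; the values at most s moved to `A`; and the
  -- negative part of X where values were replaced.
  let R : E.space := ε • I + (2 * t) • restrict I D hD + Q + s • restrict I A hA +
    restrict (negPart X) (A ∪ G) hAG
  have hR : ∀ᵐ ω ∂μ, (R : Ω →ₘ[μ] ℝ) ω = ε + 2 * t * D.indicator 1 ω +
      G.indicator (fun ω => ∑ i, l i * g ω i) ω + s * A.indicator 1 ω +
      (A ∪ G).indicator (fun ω => max (-(X : Ω →ₘ[μ] ℝ) ω) 0) ω := by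
    filter_upwards [coeFn_add (ε • I + (2 * t) • restrict I D hD + Q + s • restrict I A hA)
        (restrict (negPart X) (A ∪ G) hAG),
      coeFn_add (ε • I + (2 * t) • restrict I D hD + Q) (s • restrict I A hA),
      coeFn_add (ε • I + (2 * t) • restrict I D hD) Q,
      coeFn_add (ε • I) ((2 * t) • restrict I D hD), coeFn_smul ε I,
      coeFn_smul (2 * t) (restrict I D hD), coeFn_smul s (restrict I A hA),
      coeFn_restrict I hD, coeFn_restrict I hA, coeFn_restrict (negPart X) hAG,
      coeFn_negPart X, hI, hQ] with ω h1 h2 h3 h4 h5 h6 h7 h8 h9 h10 h11 h12 h13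
    have hind : ∀ C : Set Ω, C.indicator (I : Ω →ₘ[μ] ℝ) ω = C.indicator 1 ω := by
      intro C
      simp only [Set.indicator, h12, Pi.one_apply]
    have hneg : ∀ C : Set Ω, C.indicator (negPart X : Ω →ₘ[μ] ℝ) ω =
        C.indicator (fun ω => max (-(X : Ω →ₘ[μ] ℝ) ω) 0) ω := by
      intro C
      simp only [Set.indicator, h11]
    simp only [R]
    rw [h1, h2, h3, h4, h5, h6, h7, h8, h9, h10, h12, h13, hind, hind, hneg, mul_one]
  have hind0 : ∀ (C : Set Ω) ω, 0 ≤ C.indicator (1 : Ω → ℝ) ω := fun C ω =>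
    Set.indicator_nonneg (fun _ _ => zero_le_one) ω
  have hneg0 : ∀ (C : Set Ω) ω,
      0 ≤ C.indicator (fun ω => max (-(X : Ω →ₘ[μ] ℝ) ω) 0) ω := fun C ω =>
    Set.indicator_nonneg (fun _ _ => le_max_right _ _) ω
  have hG0 : ∀ᵐ ω ∂μ, 0 ≤ G.indicator (fun ω => ∑ i, l i * g ω i) ω := by
    filter_upwards [hg0] with ω h
    exact Set.indicator_apply_nonneg fun hω =>
      Finset.sum_nonneg fun i _ => mul_nonneg (hl0 i) (h hω i)
  refine ⟨Y, W, R, A ∪ G, hAG, AEEqFun.coeFn_le.1 ?_, hWY, AEEqFun.coeFn_le.1 ?_, ?_, ?_, ?_⟩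
  · filter_upwards [hYA, hYU, hU] with ω h1 h2 h3
    by_cases hω : ω ∈ A
    · rw [h1 hω]
      exact (le_abs_self _).trans h3
    · rw [h2 hω]
  · filter_upwards [hR, hG0, hg0, ae_all_iff.2 hW, hYU, hX, hU, coeFn_add X R,
      coeFn_sum Finset.univ fun i => l i • W i,
      ae_all_iff.2 fun i => coeFn_smul (l i) (W i)] with ω hR hG0 hg0 hW hYU hX hU h1 h2 h3
    rw [h2, h1, hR, Finset.sum_congr rfl fun i _ => h3 i]
    have hD0 : 0 ≤ 2 * t * D.indicator (1 : Ω → ℝ) ω := mul_nonneg (by positivity) (hind0 D ω)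
    have hmax := le_max_left (-(X : Ω →ₘ[μ] ℝ) ω) 0
    by_cases hωA : ω ∈ A
    · calc ∑ i, l i * (W i : Ω →ₘ[μ] ℝ) ω ≤ ∑ i, l i * s :=
            Finset.sum_le_sum fun i _ => mul_le_mul_of_nonneg_left ((hW i).1 hωA) (hl0 i)
        _ = s := by rw [← Finset.sum_mul, hl1, one_mul]
        _ ≤ _ := by
          rw [Set.indicator_of_mem hωA, Set.indicator_of_mem (Set.mem_union_left _ hωA),
            Pi.one_apply]
          linarith
    · have hUX : (U : Ω →ₘ[μ] ℝ) ω ≤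
          (X : Ω →ₘ[μ] ℝ) ω + ε + 2 * t * D.indicator (1 : Ω → ℝ) ω := by
        by_cases hωD : ω ∈ D
        · have hX₀t : (X₀ : Ω →ₘ[μ] ℝ) ω ≤ t := by
            rw [hAt] at hωA
            exact not_lt.1 hωA
          rw [Set.indicator_of_mem hωD, Pi.one_apply]
          have h5 := (abs_le.1 hX).1
          have h6 := (abs_le.1 hU).2
          linarith
        · have : ¬ ε ≤ |(U : Ω →ₘ[μ] ℝ) ω - (X : Ω →ₘ[μ] ℝ) ω| := by
            rw [hDε] at hωD
            exact hωD
          have h5 := (abs_lt.1 (not_le.1 this)).2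
          linarith
      rw [Set.indicator_of_notMem hωA]
      by_cases hωG : ω ∈ G
      · rw [Set.indicator_of_mem hωG, Set.indicator_of_mem (Set.mem_union_right _ hωG)]
        -- On `G` either W_i = g_i, and X + X⁻ ≥ 0 gives the bound, or W_i = U, and g_i ≥ 0 may be
        -- added.
        have hWi : ∀ i, (W i : Ω →ₘ[μ] ℝ) ω ≤ ((X : Ω →ₘ[μ] ℝ) ω + ε +
            2 * t * D.indicator (1 : Ω → ℝ) ω + max (-(X : Ω →ₘ[μ] ℝ) ω) 0) + g ω i := by
          intro i
          have h5 := hg0 hωG i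
          by_cases hωi : t < g ω i
          · rw [(hW i).2.1 ⟨hωG, hωi⟩]
            linarith
          · rw [(hW i).2.2 hωA fun h => hωi h.2, hYU hωA]
            have := le_max_right (-(X : Ω →ₘ[μ] ℝ) ω) 0
            linarith
        refine (Finset.sum_le_sum fun i _ => mul_le_mul_of_nonneg_left (hWi i) (hl0 i)).trans ?_
        simp only [mul_add _ _ (g ω _), Finset.sum_add_distrib, ← Finset.sum_mul, hl1]
        linarith
      · have hWi : ∀ i, (W i : Ω →ₘ[μ] ℝ) ω = (U : Ω →ₘ[μ] ℝ) ω := fun i => by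
          rw [(hW i).2.2 hωA fun h => hωG h.1, hYU hωA]
        simp only [hWi, ← Finset.sum_mul, hl1, one_mul]
        have := hneg0 (A ∪ G) ω
        linarith
  · filter_upwards [hR, hG0] with ω h1 h2
    rw [h1]
    have h3 := hind0 D ω
    have h4 := hind0 A ω
    have h5 := hneg0 (A ∪ G) ω
    positivity
  · rw [← hGS]
    exact measure_union_le _ _
  · rw [← hQl.norm_eq]
    refine (norm_add_le _ _).trans (add_le_add_left ?_ _)
    refine (norm_add_le _ _).trans (add_le_add ?_ ?_)
    · refine (norm_add_le _ _).trans (add_le_add_left ?_ _)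
      refine (norm_add_le _ _).trans (add_le_add ?_ ?_)
      · rw [norm_smul, Real.norm_of_nonneg hε]
      · rw [norm_smul, Real.norm_of_nonneg (by positivity)]
    · rw [norm_smul, Real.norm_of_nonneg hs]

end Rearrangement

/-! ### AOCEA implies the Fatou property -/

theorem self_mem_equidistributedHull (X : E.space) : X ∈ equidistributedHull X :=
  subset_convexHull ℝ _ (IdentDistrib.refl (measurable_coe X).aemeasurable)

theorem bddBelow_image2_norm_sub (A B : Set E.space) :
    BddBelow (Set.image2 (fun X Y => ‖X - Y‖) A B) := by
  refine ⟨0, ?_⟩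
  rintro _ ⟨X, -, Y, -, rfl⟩
  exact norm_nonneg _

theorem setDist_le_norm_sub {A B : Set E.space} {X Y : E.space} (hX : X ∈ A) (hY : Y ∈ B) :
    setDist A B ≤ ‖X - Y‖ :=
  csInf_le (bddBelow_image2_norm_sub A B) ⟨X, hX, Y, hY, rfl⟩

theorem setDist_nonneg (A B : Set E.space) : 0 ≤ setDist A B := by
  refine Real.sInf_nonneg ?_
  rintro _ ⟨X, -, Y, -, rfl⟩
  exact norm_nonneg _

/-- The AOCEA property provides equidistributional averages whose tails have small norm. -/
theorem AOCEA.exists_norm_restrict_tail_lt [IsProbabilityMeasure μ] (h : E.AOCEA) {X : E.space}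
    (hX : 0 ≤ (X : Ω →ₘ[μ] ℝ)) {ε : ℝ} (hε : 0 < ε) :
    ∃ (ι : Type) (_ : Fintype ι) (l : ι → ℝ) (Z : ι → E.space), (∀ i, 0 ≤ l i) ∧
      ∑ i, l i = 1 ∧ (∀ i, SameLaw (Z i) X) ∧
      Tendsto (fun t : ℝ => μ {ω | ∃ i, t < (Z i : Ω →ₘ[μ] ℝ) ω}) atTop (𝓝 0) ∧
      ∃ δ : ℝ, 0 < δ ∧ ∀ (A : Set Ω) (hA : MeasurableSet A), μ A < ENNReal.ofReal δ →
        ‖restrict (∑ i, l i • Z i) A hA‖ < ε := by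
  have h1 : setDist (equidistributedHull X) E.orderContinuousPart < ε / 2 := by
    rw [h X hX]
    exact half_pos hε
  obtain ⟨_, ⟨Q, hQ, V, hV, rfl⟩, hQV⟩ := exists_lt_of_csInf_lt
    (Set.Nonempty.image2 ⟨X, self_mem_equidistributedHull X⟩
      ⟨0, zero_mem_orderContinuousPart⟩) h1
  obtain ⟨ι, _, l, Z, hl0, hl1, hZ, rfl⟩ := mem_convexHull_iff_exists_fintype.1 hQ
  refine ⟨ι, inferInstance, l, Z, hl0, hl1, hZ, ?_, ?_⟩
  · have h2 : Tendsto (fun t : ℝ => ∑ i, μ {ω | t < (Z i : Ω →ₘ[μ] ℝ) ω}) atTop (𝓝 0) := by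
      have := tendsto_finsetSum Finset.univ fun i (_ : i ∈ Finset.univ) =>
        tendsto_measure_coeFn_gt_atTop (Z i)
      simpa using this
    refine tendsto_of_tendsto_of_tendsto_of_le_of_le tendsto_const_nhds h2 (fun _ => zero_le)
      fun t => ?_
    have : {ω | ∃ i, t < (Z i : Ω →ₘ[μ] ℝ) ω} = ⋃ i, {ω | t < (Z i : Ω →ₘ[μ] ℝ) ω} := by
      ext ω; simp
    simp only [this]
    exact measure_iUnion_fintype_le _ _
  · obtain ⟨δ, hδ, hVδ⟩ := hV (ε / 2) (half_pos hε)
    refine ⟨δ, hδ, fun A hA hAδ => ?_⟩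
    have h3 := hVδ A hA hAδ
    have h4 := norm_restrict_le (∑ i, l i • Z i - V) hA
    -- The difference to `V` is small on every set, while `V` itself is small on small sets.
    have h5 : restrict (∑ i, l i • Z i) A hA =
        restrict (∑ i, l i • Z i - V) A hA + restrict V A hA := by
      rw [← restrict_add, sub_add_cancel]
    rw [h5]
    refine (norm_add_le _ _).trans_lt ?_
    simp only at hQV
    linarith

theorem fatouAt_of_forall_eventually {ρ : E.space → ℝ} {X : E.space}
    (h : ∀ u : ℕ → E.space, OrderConverges u X → ∀ δ : ℝ, 0 < δ →
      ∀ᶠ n in atTop, ρ X - δ ≤ ρ (u n)) : FatouAt ρ X := by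
  intro u hu
  refine EReal.ge_of_forall_gt_iff_ge.1 fun z hz => ?_
  have hz' : z < ρ X := by exact_mod_cast hz
  refine le_liminf_of_le (by isBoundedDefault) ?_
  filter_upwards [h u hu (ρ X - z) (sub_pos.2 hz')] with n hn
  rw [sub_sub_cancel] at hn
  exact_mod_cast hn

/-- Under the AOCEA property, convex decreasing law-invariant functionals have the Fatou property
at every `X` with order continuous negative part. -/
theorem AOCEA.fatouAt [IsProbabilityMeasure μ] (hμ : IsNonatomic μ) {I : E.space}
    (hI : ∀ᵐ ω ∂μ, (I : Ω →ₘ[μ] ℝ) ω = 1) (hIa : I ∈ E.orderContinuousPart) (h : E.AOCEA)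
    {ρ : E.space → ℝ} (hconv : ConvexOn ℝ Set.univ ρ) (hdec : IsDecreasing ρ)
    (hlaw : LawInvariant ρ) {X : E.space} (hX : negPart X ∈ E.orderContinuousPart) :
    FatouAt ρ X := by
  refine fatouAt_of_forall_eventually ?_
  rintro u ⟨hu, X₀, hX₀⟩ δ hδ
  obtain ⟨η, hη, hρ⟩ := exists_sub_le_of_convexOn hconv hdec X hδ
  have hXX₀ : ∀ᵐ ω ∂μ, |(X : Ω →ₘ[μ] ℝ) ω| ≤ (X₀ : Ω →ₘ[μ] ℝ) ω := by
    filter_upwards [hu, ae_all_iff.2 hX₀] with ω h1 h2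
    exact le_of_tendsto' h1.abs h2
  have hX₀0 : 0 ≤ (X₀ : Ω →ₘ[μ] ℝ) := by
    refine AEEqFun.coeFn_le.1 ?_
    filter_upwards [hXX₀, AEEqFun.coeFn_zero (μ := μ) (β := ℝ)] with ω h1 h2
    rw [h2]
    exact (abs_nonneg _).trans h1
  obtain ⟨ι, _, l, Z, hl0, hl1, hZ, htail, δ₁, hδ₁, hQ⟩ :=
    h.exists_norm_restrict_tail_lt hX₀0 (ε := η / 5) (by positivity)
  have htail₀ := tendsto_measure_coeFn_gt_atTop X₀
  -- X₀ ≤ s on at least half of Ω leaves room for the set receiving the large values.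
  obtain ⟨s, hs, hs0⟩ := ((htail₀.eventually_lt_const (show (0 : ENNReal) < 2⁻¹ by simp)).and
    (eventually_ge_atTop 0)).exists
  have hsc : (2 : ENNReal)⁻¹ ≤ μ {ω | (X₀ : Ω →ₘ[μ] ℝ) ω ≤ s} := by
    have h1 := prob_compl_eq_one_sub (μ := μ)
      (measurableSet_lt measurable_const (measurable_coe X₀) :
        MeasurableSet {ω | s < (X₀ : Ω →ₘ[μ] ℝ) ω})
    have h2 : {ω | s < (X₀ : Ω →ₘ[μ] ℝ) ω}ᶜ = {ω | (X₀ : Ω →ₘ[μ] ℝ) ω ≤ s} := by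
      ext ω; simp
    rw [← h2, h1]
    calc (2 : ENNReal)⁻¹ = 1 - 2⁻¹ := ENNReal.one_sub_inv_two.symm
      _ ≤ _ := tsub_le_tsub_left hs.le 1
  obtain ⟨δ₂, hδ₂, hX₂⟩ := hX (η / 5) (by positivity)
  obtain ⟨δ₃, hδ₃, hI₃⟩ := hIa (η / (5 * (s + 1))) (by positivity)
  have hAS : Tendsto (fun t : ℝ => μ {ω | t < (X₀ : Ω →ₘ[μ] ℝ) ω} +
      μ {ω | ∃ i, t < (Z i : Ω →ₘ[μ] ℝ) ω}) atTop (𝓝 0) := by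
    simpa using htail₀.add htail
  -- Each of the five terms bounding ‖R‖ gets η/5. The level t depends on s; the bound δ₄ on the
  -- measure of `D` must come after t because of the factor 2t, and n is chosen last.
  obtain ⟨t, ht2, ht1, ht, htA, hst⟩ := ((htail.eventually_lt_const
    (show (0 : ENNReal) < 2⁻¹ by simp)).and
    ((htail.eventually (gt_mem_nhds (ENNReal.ofReal_pos.2 hδ₁))).and
    ((hAS.eventually (gt_mem_nhds (ENNReal.ofReal_pos.2 hδ₂))).and
    ((htail₀.eventually (gt_mem_nhds (ENNReal.ofReal_pos.2 hδ₃))).and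
    (eventually_ge_atTop s))))).exists
  have ht0 : 0 ≤ t := hs0.trans hst
  let ε : ℝ := η / (5 * (‖I‖ + 1))
  have hε : 0 < ε := by positivity
  obtain ⟨δ₄, hδ₄, hI₄⟩ := hIa (η / (5 * (2 * t + 1))) (by positivity)
  have hconvm : ∀ ε : ℝ, 0 < ε → Tendsto (fun n => μ {ω | ε ≤ ‖(u n : Ω →ₘ[μ] ℝ) ω -
      (X : Ω →ₘ[μ] ℝ) ω‖}) atTop (𝓝 0) :=
    tendstoInMeasure_iff_norm.1 (tendstoInMeasure_of_tendsto_ae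
      (fun n => (u n : Ω →ₘ[μ] ℝ).aestronglyMeasurable) hu)
  filter_upwards [(hconvm ε hε).eventually (gt_mem_nhds (ENNReal.ofReal_pos.2 hδ₄))] with n hn
  have hA : MeasurableSet {ω | t < (X₀ : Ω →ₘ[μ] ℝ) ω} :=
    measurableSet_lt measurable_const (measurable_coe X₀)
  have hD : MeasurableSet {ω | ε ≤ |(u n : Ω →ₘ[μ] ℝ) ω - (X : Ω →ₘ[μ] ℝ) ω|} :=
    measurableSet_le measurable_const ((measurable_coe (u n)).sub (measurable_coe X)).abs
  have hS : MeasurableSet {ω | ∃ i, t < (Z i : Ω →ₘ[μ] ℝ) ω} := by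
    have : {ω | ∃ i, t < (Z i : Ω →ₘ[μ] ℝ) ω} = ⋃ i, {ω | t < (Z i : Ω →ₘ[μ] ℝ) ω} := by
      ext ω; simp
    rw [this]
    exact MeasurableSet.iUnion fun i => measurableSet_lt measurable_const (measurable_coe (Z i))
  obtain ⟨Y, W, R, B, hB, hUY, hWY, hWR, hR0, hBAS, hRn⟩ := exists_sum_sameLaw_le hμ hI hXX₀
    (hX₀ n) hl0 hl1 hZ hs0 hst hε.le hA hD hS rfl rfl rfl (ht2.le.trans hsc)
  have hRη : ‖R‖ < η := by
    refine hRn.trans_lt ?_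
    have h1 : ε * ‖I‖ ≤ η / 5 := by
      have : ε * (‖I‖ + 1) = η / 5 := by simp only [ε]; field_simp
      nlinarith
    have h2 := hI₄ _ hD hn
    rw [lt_div_iff₀ (by positivity)] at h2
    have h3 := hI₃ _ hA htA
    rw [lt_div_iff₀ (by positivity)] at h3
    have h4 := hQ _ hS ht1
    have h5 := hX₂ B hB (hBAS.trans_lt ht)
    have h6 := norm_nonneg (restrict I _ hA)
    have h7 := norm_nonneg (restrict I _ hD)
    linarith
  calc ρ X - δ ≤ ρ (X + R) := hρ R hR0 hRη
    _ ≤ ρ (∑ i, l i • W i) := hdec _ _ hWR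
    _ ≤ ∑ i, l i • ρ (W i) :=
      hconv.map_sum_le (fun i _ => hl0 i) hl1 fun i _ => Set.mem_univ _
    _ = ρ Y := by
      simp only [fun i => hlaw _ _ (hWY i), smul_eq_mul, ← Finset.sum_mul, hl1, one_mul]
    _ ≤ ρ (u n) := hdec _ _ hUY

/-! ### Positive functionals and the risk measures they generate -/

open scoped Pointwise in
/-- A convex upward closed set at positive distance from a subspace is separated from it by a
positive functional. -/
theorem exists_nonneg_functional (M : Submodule ℝ E.space) {K : Set E.space} (hK : Convex ℝ K)
    (hne : K.Nonempty)
    (hup : ∀ X ∈ K, ∀ P : E.space, (∀ᵐ ω ∂μ, 0 ≤ (P : Ω →ₘ[μ] ℝ) ω) → X + P ∈ K)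
    {d : ℝ} (hd : 0 < d) (hdist : ∀ X ∈ K, ∀ V ∈ M, d ≤ ‖X - V‖) :
    ∃ (φ : StrongDual ℝ E.space) (c : ℝ), 0 < c ∧ (∀ V ∈ M, φ V = 0) ∧
      (∀ P : E.space, (∀ᵐ ω ∂μ, 0 ≤ (P : Ω →ₘ[μ] ℝ) ω) → 0 ≤ φ P) ∧ ∀ X ∈ K, c ≤ φ X := by
  have hdisj : Disjoint ((M : Set E.space) + Metric.ball 0 d) K := by
    rw [Set.disjoint_left]
    rintro _ ⟨V, hV, B, hB, rfl⟩ hX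
    have h1 := hdist _ hX V hV
    simp only [add_sub_cancel_left] at h1
    exact absurd h1 (not_le.2 (mem_ball_zero_iff.1 hB))
  obtain ⟨φ, c, hφ, hc⟩ := geometric_hahn_banach_open
    (M.convex.add (convex_ball (0 : E.space) d)) Metric.isOpen_ball.add_left hK hdisj
  have hM : ∀ V ∈ M, φ V < c := fun V hV =>
    hφ V ⟨V, hV, 0, Metric.mem_ball_self hd, add_zero V⟩
  have hc0 : 0 < c := by simpa using hM 0 M.zero_mem
  refine ⟨φ, c, hc0, fun V hV => ?_, fun P hP => ?_, hc⟩
  -- A functional bounded above on a subspace vanishes there: otherwise some multiple of V would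
  -- attain the value c.
  · by_contra h0
    have h1 := hM ((c / φ V) • V) (M.smul_mem _ hV)
    rw [map_smul, smul_eq_mul, div_mul_cancel₀ _ h0] at h1
    exact lt_irrefl _ h1
  -- Adding large multiples of P stays in `K` but would make φ negative.
  · by_contra! hlt
    obtain ⟨X, hX⟩ := hne
    obtain ⟨n, hn⟩ := exists_nat_gt (φ X / -φ P)
    rw [div_lt_iff₀ (neg_pos.2 hlt)] at hn
    have h1 := hc _ (hup X hX ((n : ℝ) • P) (by
      filter_upwards [hP, coeFn_smul (n : ℝ) P] with ω h1 h2
      rw [h2]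
      positivity))
    rw [map_add, map_smul, smul_eq_mul] at h1
    linarith

/-- The smallest value of a functional over all random variables with the law of `Y`. -/
noncomputable def lawInf (Φ : StrongDual ℝ E.space) (Y : E.space) : ℝ :=
  sInf (Φ '' {Z | SameLaw Z Y})

section LawInf

variable {Φ : StrongDual ℝ E.space}

theorem sameLaw_refl (Y : E.space) : SameLaw Y Y :=
  IdentDistrib.refl (measurable_coe Y).aemeasurable

theorem SameLaw.ae_nonneg {Z Y : E.space} (h : SameLaw Z Y)
    (hY : ∀ᵐ ω ∂μ, 0 ≤ (Y : Ω →ₘ[μ] ℝ) ω) : ∀ᵐ ω ∂μ, 0 ≤ (Z : Ω →ₘ[μ] ℝ) ω :=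
  h.symm.ae_mem_snd (t := Set.Ici 0) measurableSet_Ici hY

theorem lawInf_le {Z Y : E.space} (h : SameLaw Z Y) : lawInf Φ Y ≤ Φ Z := by
  -- The norm is constant on the law class, so `Φ` is bounded below there.
  refine csInf_le ⟨-(‖Φ‖ * ‖Y‖), ?_⟩ ⟨Z, h, rfl⟩
  rintro _ ⟨W, hW, rfl⟩
  have h1 := Φ.le_opNorm W
  rw [SameLaw.norm_eq hW] at h1
  exact (abs_le.1 h1).1

theorem le_lawInf {a : ℝ} {Y : E.space} (h : ∀ Z, SameLaw Z Y → a ≤ Φ Z) : a ≤ lawInf Φ Y := by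
  refine le_csInf ⟨Φ Y, Y, sameLaw_refl Y, rfl⟩ ?_
  rintro _ ⟨Z, hZ, rfl⟩
  exact h Z hZ

theorem lawInf_congr {X Y : E.space} (h : SameLaw X Y) : lawInf Φ X = lawInf Φ Y :=
  le_antisymm (le_lawInf fun _ hZ => lawInf_le (hZ.trans h.symm))
    (le_lawInf fun _ hZ => lawInf_le (hZ.trans h))

theorem SameLaw.smul {X Y : E.space} (h : SameLaw X Y) (c : ℝ) : SameLaw (c • X) (c • Y) :=
  ((IdentDistrib.of_ae_eq (measurable_coe _).aemeasurable (coeFn_smul c X)).trans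
    (h.comp (measurable_const_mul c))).trans
    (IdentDistrib.of_ae_eq (measurable_coe _).aemeasurable (coeFn_smul c Y)).symm

theorem lawInf_zero : lawInf Φ 0 = 0 := by
  refine le_antisymm ((lawInf_le (sameLaw_refl 0)).trans_eq (map_zero Φ)) (le_lawInf fun Z hZ => ?_)
  have h0 : Z = 0 := norm_eq_zero.1 (hZ.norm_eq.trans norm_zero)
  rw [h0, map_zero]

theorem lawInf_smul {c : ℝ} (hc : 0 ≤ c) (Y : E.space) : lawInf Φ (c • Y) = c * lawInf Φ Y := by
  rcases hc.eq_or_lt with rfl | hc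
  · rw [zero_smul, zero_mul, lawInf_zero]
  refine le_antisymm ?_ (le_lawInf fun Z hZ => ?_)
  · rw [← div_le_iff₀' hc]
    refine le_lawInf fun Z hZ => ?_
    rw [div_le_iff₀' hc, ← smul_eq_mul, ← map_smul]
    exact lawInf_le (hZ.smul c)
  · have h1 := hZ.smul c⁻¹
    rw [inv_smul_smul₀ hc.ne'] at h1
    have h2 := lawInf_le (Φ := Φ) h1
    rwa [map_smul, smul_eq_mul, inv_mul_eq_div, le_div_iff₀' hc] at h2

/-- A copy Z of X + Y is within ε of X' + Y' for copies X', Y' of X and Y. Positivity and `Φ I = 1`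
turn this uniform error into an error ε in the value. -/
theorem lawInf_add_le [IsProbabilityMeasure μ] (hμ : IsNonatomic μ) {I : E.space}
    (hI : ∀ᵐ ω ∂μ, (I : Ω →ₘ[μ] ℝ) ω = 1)
    (hΦ0 : ∀ P : E.space, (∀ᵐ ω ∂μ, 0 ≤ (P : Ω →ₘ[μ] ℝ) ω) → 0 ≤ Φ P) (hΦI : Φ I = 1)
    (X Y : E.space) :
    lawInf Φ X + lawInf Φ Y ≤ lawInf Φ (X + Y) := by
  refine le_lawInf fun Z hZ => le_of_forall_pos_le_add fun ε hε => ?_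
  have hX := measurable_coe X
  have hY := measurable_coe Y
  obtain ⟨g, hg, hgf, hgZ⟩ := hμ.exists_identDistrib_abs_sub_le
    (f := fun ω => ((X : Ω →ₘ[μ] ℝ) ω, (Y : Ω →ₘ[μ] ℝ) ω)) (hX.prodMk hY)
    (h := fun p => p.1 + p.2) (by fun_prop) (measurable_coe Z)
    (hZ.trans (IdentDistrib.of_ae_eq (measurable_coe _).aemeasurable (coeFn_add X Y))) hε
  obtain ⟨X', hX', hXX⟩ := exists_coeFn_of_identDistrib X (hgf.comp measurable_fst)
  obtain ⟨Y', hY', hYY⟩ := exists_coeFn_of_identDistrib Y (hgf.comp measurable_snd)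
  have h1 := hΦ0 (Z + ε • I - (X' + Y')) (by
    filter_upwards [hX', hY', hgZ, hI, coeFn_sub (Z + ε • I) (X' + Y'), coeFn_add Z (ε • I),
      coeFn_add X' Y', coeFn_smul ε I] with ω h1 h2 h3 h4 h5 h6 h7 h8
    rw [h5, h6, h7, h8, h4, h1, h2]
    have := (abs_le.1 h3).2
    simp only [Function.comp_apply]
    linarith)
  rw [map_sub, map_add, map_add, map_smul, hΦI, smul_eq_mul, mul_one] at h1
  have h2 := lawInf_le (Φ := Φ) hXX
  have h3 := lawInf_le (Φ := Φ) hYY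
  linarith

theorem le_lawInf_smul_one {I : E.space}
    (hI : ∀ᵐ ω ∂μ, (I : Ω →ₘ[μ] ℝ) ω = 1) (hΦI : Φ I = 1) (m : ℝ) : m ≤ lawInf Φ (m • I) := by
  refine le_lawInf fun Z hZ => ?_
  have hmI : ∀ᵐ ω ∂μ, ((m • I : E.space) : Ω →ₘ[μ] ℝ) ω ∈ ({m} : Set ℝ) := by
    filter_upwards [hI, coeFn_smul m I] with ω h1 h2
    rw [h2, h1, mul_one]
    rfl
  have hZm : Z = m • I := by
    refine ext_ae ?_
    filter_upwards [hmI, IdentDistrib.ae_mem_snd hZ.symm (measurableSet_singleton m) hmI]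
      with ω h1 h2
    rw [Set.mem_singleton_iff.1 h1, Set.mem_singleton_iff.1 h2]
  rw [hZm, map_smul, hΦI, smul_eq_mul, mul_one]

/-- Superadditivity of `lawInf` carries everything but homogeneity; monotonicity follows from X = Y
+ (X - Y). -/
theorem isCoherentRiskMeasure_neg_lawInf [IsProbabilityMeasure μ] (hμ : IsNonatomic μ) {I : E.space}
    (hI : ∀ᵐ ω ∂μ, (I : Ω →ₘ[μ] ℝ) ω = 1)
    (hΦ0 : ∀ P : E.space, (∀ᵐ ω ∂μ, 0 ≤ (P : Ω →ₘ[μ] ℝ) ω) → 0 ≤ Φ P) (hΦI : Φ I = 1) :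
    IsCoherentRiskMeasure fun Y => -lawInf Φ Y := by
  have hadd := lawInf_add_le hμ hI hΦ0 hΦI
  have hone := le_lawInf_smul_one hI hΦI
  refine ⟨fun X Y hYX => ?_, fun X Y => ?_, fun c X hc => ?_, fun X Y m hXY => ?_⟩
  · have h1 : 0 ≤ lawInf Φ (X - Y) := le_lawInf fun Z hZ => hΦ0 Z (hZ.ae_nonneg (by
      filter_upwards [AEEqFun.coeFn_le.2 hYX, coeFn_sub X Y] with ω h1 h2
      rw [h2]
      exact sub_nonneg.2 h1))
    have h2 := hadd Y (X - Y)
    rw [add_sub_cancel] at h2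
    linarith
  · have := hadd X Y
    linarith
  · rw [lawInf_smul hc, mul_neg]
  · have hY : Y = X + m • I := by
      refine ext_ae ?_
      have h0 := AEEqFun.coeFn_add (X : Ω →ₘ[μ] ℝ) (AEEqFun.const Ω m)
      rw [← hXY] at h0
      filter_upwards [h0, AEEqFun.coeFn_const Ω (μ := μ) m, hI, coeFn_smul m I,
        coeFn_add X (m • I)] with ω h1 h2 h3 h4 h5
      rw [h1, h5, h4, h3, Pi.add_apply, h2, mul_one, Function.const_apply]
    -- Superadditivity is used for the passage from X to X + m and for the way back; together they
    -- give equality.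
    have hX : X = Y + (-m) • I := by rw [hY]; module
    have h1 := hadd X (m • I)
    rw [← hY] at h1
    have h2 := hadd Y ((-m) • I)
    rw [← hX] at h2
    have h3 := hone m
    have h4 := hone (-m)
    linarith

end LawInf

/-! ### Failure of AOCEA breaks the Fatou property -/

/-- A positive functional normalized at the constant `1`. -/
theorem exists_normalized_functional [IsProbabilityMeasure μ] {I : E.space}
    (hI : ∀ᵐ ω ∂μ, (I : Ω →ₘ[μ] ℝ) ω = 1) :
    ∃ ψ : StrongDual ℝ E.space,
      (∀ P : E.space, (∀ᵐ ω ∂μ, 0 ≤ (P : Ω →ₘ[μ] ℝ) ω) → 0 ≤ ψ P) ∧ ψ I = 1 := by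
  have hI0 : I ≠ 0 := by
    rintro rfl
    have h : ∀ᵐ ω ∂μ, False := by
      filter_upwards [hI, coeFn_zero (E := E)] with ω h1 h2
      exact zero_ne_one (h2.symm.trans h1)
    exact h.exists.choose_spec
  -- Separation of {W ≥ 1} from 0: by solidity every such W has norm at least ‖I‖.
  obtain ⟨ψ, c, hc, -, hψ0, hψ⟩ := exists_nonneg_functional (⊥ : Submodule ℝ E.space)
    (K := {W : E.space | ∀ᵐ ω ∂μ, (1 : ℝ) ≤ (W : Ω →ₘ[μ] ℝ) ω})
    (by
      intro X hX Y hY a b ha hb hab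
      filter_upwards [hX, hY, coeFn_add (a • X) (b • Y), coeFn_smul a X, coeFn_smul b Y]
        with ω h1 h2 h3 h4 h5
      rw [h3, h4, h5]
      nlinarith)
    ⟨I, hI.mono fun ω h => h.ge⟩
    (by
      intro X hX P hP
      filter_upwards [hX, hP, coeFn_add X P] with ω h1 h2 h3
      rw [h3]
      linarith)
    (norm_pos_iff.2 hI0)
    (by
      intro X hX V hV
      rw [(Submodule.mem_bot ℝ).1 hV, sub_zero]
      refine norm_le_of_abs_le ?_
      filter_upwards [hX, hI] with ω h1 h2
      rw [h2, abs_one]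
      exact h1.trans (le_abs_self _))
  have hψI : 0 < ψ I := hc.trans_le (hψ I (hI.mono fun ω h => h.ge))
  refine ⟨(ψ I)⁻¹ • ψ, fun P hP => ?_, ?_⟩
  · exact mul_nonneg (inv_nonneg.2 hψI.le) (hψ0 P hP)
  · exact inv_mul_cancel₀ hψI.ne'

/-- If equidistributional averages of `X` stay away from the order continuous part, then some
positive functional vanishing on this part is bounded below on the law of `X`. -/
theorem exists_singular_functional {X : E.space} (hX : 0 ≤ (X : Ω →ₘ[μ] ℝ))
    (hd : 0 < setDist (equidistributedHull X) E.orderContinuousPart) :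
    ∃ (φ : StrongDual ℝ E.space) (c : ℝ), 0 < c ∧ (∀ V ∈ E.orderContinuousPart, φ V = 0) ∧
      (∀ P : E.space, (∀ᵐ ω ∂μ, 0 ≤ (P : Ω →ₘ[μ] ℝ) ω) → 0 ≤ φ P) ∧
      ∀ Z, SameLaw Z X → c ≤ φ Z := by
  have hX0 : ∀ᵐ ω ∂μ, 0 ≤ (X : Ω →ₘ[μ] ℝ) ω := by
    filter_upwards [AEEqFun.coeFn_le.2 hX, AEEqFun.coeFn_zero (μ := μ) (β := ℝ)] with ω h1 h2
    rwa [h2] at h1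
  have hpos : ∀ Y ∈ equidistributedHull X, ∀ᵐ ω ∂μ, 0 ≤ (Y : Ω →ₘ[μ] ℝ) ω := by
    refine fun Y hY => convexHull_min (t := {Y : E.space | ∀ᵐ ω ∂μ, 0 ≤ (Y : Ω →ₘ[μ] ℝ) ω})
      (fun Z hZ => SameLaw.ae_nonneg hZ hX0) ?_ hY
    intro Y hY Z hZ a b ha hb hab
    filter_upwards [hY, hZ, coeFn_add (a • Y) (b • Z), coeFn_smul a Y, coeFn_smul b Z]
      with ω h1 h2 h3 h4 h5
    rw [h3, h4, h5]
    positivity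
  -- The hull is enlarged upwards, which makes the separating functional positive.
  let K : Set E.space := {W | ∃ Y ∈ equidistributedHull X,
    ∀ᵐ ω ∂μ, (Y : Ω →ₘ[μ] ℝ) ω ≤ (W : Ω →ₘ[μ] ℝ) ω}
  have hXK : ∀ Z, SameLaw Z X → Z ∈ K := fun Z hZ =>
    ⟨Z, subset_convexHull ℝ _ hZ, Eventually.of_forall fun ω => le_rfl⟩
  obtain ⟨φ, c, hc, hφa, hφ0, hφK⟩ := exists_nonneg_functional (E.orderContinuousSubmodule)
    (K := K)
    (by
      rintro W ⟨Y, hY, hYW⟩ W' ⟨Y', hY', hYW'⟩ a b ha hb hab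
      refine ⟨a • Y + b • Y', convex_convexHull ℝ _ hY hY' ha hb hab, ?_⟩
      filter_upwards [hYW, hYW', coeFn_add (a • W) (b • W'), coeFn_smul a W, coeFn_smul b W',
        coeFn_add (a • Y) (b • Y'), coeFn_smul a Y, coeFn_smul b Y']
        with ω h1 h2 h3 h4 h5 h6 h7 h8
      rw [h3, h4, h5, h6, h7, h8]
      gcongr)
    ⟨X, hXK X (sameLaw_refl X)⟩
    (by
      rintro W ⟨Y, hY, hYW⟩ P hP
      refine ⟨Y, hY, ?_⟩
      filter_upwards [hYW, hP, coeFn_add W P] with ω h1 h2 h3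
      rw [h3]
      linarith)
    hd
    (by
      rintro W ⟨Y, hY, hYW⟩ V hV
      -- The enlargement does not reduce the distance: V' = min(Y, V⁺) is again in 𝒳ₐ by solidity,
      -- and |Y - V'| ≤ |W - V| because Y ≤ W.
      obtain ⟨V', hV'⟩ := exists_coeFn_of_abs_le V
        (f := fun ω => min ((Y : Ω →ₘ[μ] ℝ) ω) (max ((V : Ω →ₘ[μ] ℝ) ω) 0))
        ((measurable_coe Y).min ((measurable_coe V).max measurable_const)).aemeasurable (by
          filter_upwards [hpos Y hY] with ω h1
          rw [abs_of_nonneg (le_min h1 (le_max_right _ _))]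
          exact (min_le_right _ _).trans (max_le (le_abs_self _) (abs_nonneg _)))
      have hV'a : V' ∈ E.orderContinuousPart := by
        refine mem_orderContinuousPart_of_abs_le hV ?_
        filter_upwards [hV', hpos Y hY] with ω h2 h1
        rw [h2, abs_of_nonneg (le_min h1 (le_max_right _ _))]
        exact (min_le_right _ _).trans (max_le (le_abs_self _) (abs_nonneg _))
      refine (setDist_le_norm_sub hY hV'a).trans (norm_le_of_abs_le ?_)
      filter_upwards [hYW, hV', coeFn_sub Y V', coeFn_sub W V] with ω h1 h2 h3 h4
      rw [h3, h4, h2, abs_of_nonneg (sub_nonneg.2 (min_le_left _ _))]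
      rcases le_total ((Y : Ω →ₘ[μ] ℝ) ω) (max ((V : Ω →ₘ[μ] ℝ) ω) 0) with h | h
      · rw [min_eq_left h, sub_self]
        exact abs_nonneg _
      · rw [min_eq_right h]
        refine le_trans ?_ (le_abs_self _)
        have := le_max_left ((V : Ω →ₘ[μ] ℝ) ω) 0
        linarith)
  exact ⟨φ, c, hc, hφa, hφ0, fun Z hZ => hφK Z (hXK Z hZ)⟩

/-- If every law-invariant coherent risk measure has the Fatou property at `0`, then the space has
the AOCEA property. -/
theorem AOCEA_of_forall_fatouAt [IsProbabilityMeasure μ] (hμ : IsNonatomic μ) {I : E.space}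
    (hI : ∀ᵐ ω ∂μ, (I : Ω →ₘ[μ] ℝ) ω = 1) (hIa : I ∈ E.orderContinuousPart)
    (h : ∀ ρ : E.space → ℝ, IsCoherentRiskMeasure ρ → LawInvariant ρ → FatouAt ρ 0) :
    E.AOCEA := by
  intro X hX
  by_contra hne
  obtain ⟨φ, c, hc, hφa, hφ0, hφX⟩ :=
    exists_singular_functional hX ((setDist_nonneg _ _).lt_of_ne' hne)
  obtain ⟨ψ, hψ0, hψI⟩ := exists_normalized_functional hI
  have hΦ0 : ∀ P : E.space, (∀ᵐ ω ∂μ, 0 ≤ (P : Ω →ₘ[μ] ℝ) ω) → 0 ≤ (ψ + φ) P := fun P hP =>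
    add_nonneg (hψ0 P hP) (hφ0 P hP)
  have hΦI : (ψ + φ) I = 1 := by
    rw [add_apply, hψI, hφa I hIa, add_zero]
  have hX0 : ∀ᵐ ω ∂μ, 0 ≤ (X : Ω →ₘ[μ] ℝ) ω := by
    filter_upwards [AEEqFun.coeFn_le.2 hX, AEEqFun.coeFn_zero (μ := μ) (β := ℝ)] with ω h1 h2
    rwa [h2] at h1
  have hA : ∀ n : ℕ, MeasurableSet {ω | (n : ℝ) < (X : Ω →ₘ[μ] ℝ) ω} := fun n =>
    measurableSet_lt measurable_const (measurable_coe X)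
  -- These tails of X tend to 0 almost surely and are dominated by X.
  let u : ℕ → E.space := fun n => restrict X _ (hA n)
  have hu : ∀ n, ∀ᵐ ω ∂μ, (u n : Ω →ₘ[μ] ℝ) ω =
      (Set.Ioi (n : ℝ)).indicator id ((X : Ω →ₘ[μ] ℝ) ω) := by
    intro n
    filter_upwards [coeFn_restrict X (hA n)] with ω h1
    rw [h1]
    rfl
  have hconv : OrderConverges u 0 := by
    refine ⟨?_, X, fun n => ?_⟩
    · filter_upwards [ae_all_iff.2 hu, coeFn_zero (E := E)] with ω h1 h2
      rw [h2]
      refine tendsto_const_nhds.congr' ?_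
      obtain ⟨N, hN⟩ := exists_nat_ge ((X : Ω →ₘ[μ] ℝ) ω)
      filter_upwards [eventually_ge_atTop N] with n hn
      rw [h1, Set.indicator_of_notMem]
      exact not_lt.2 (hN.trans (by exact_mod_cast hn))
    · filter_upwards [hu n, hX0] with ω h1 h2
      rw [h1]
      by_cases hω : (X : Ω →ₘ[μ] ℝ) ω ∈ Set.Ioi (n : ℝ)
      · rw [Set.indicator_of_mem hω, id, abs_of_nonneg h2]
      · rwa [Set.indicator_of_notMem hω, abs_zero]
  have hlow : ∀ n, c ≤ lawInf (ψ + φ) (u n) := by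
    intro n
    refine le_lawInf fun Z hZ => ?_
    have hh : Measurable ((Set.Ioi (n : ℝ)).indicator (id : ℝ → ℝ)) :=
      measurable_id.indicator measurableSet_Ioi
    have hn : (0 : ℝ) ≤ n := Nat.cast_nonneg n
    have hpos : ∀ x : ℝ, 0 ≤ (Set.Ioi (n : ℝ)).indicator (id : ℝ → ℝ) x := fun x =>
      Set.indicator_apply_nonneg fun hx => hn.trans (le_of_lt hx)
    have hZ0 : ∀ᵐ ω ∂μ, 0 ≤ (Z : Ω →ₘ[μ] ℝ) ω := hZ.ae_nonneg (by
      filter_upwards [hu n] with ω h1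
      rw [h1]
      exact hpos _)
    -- A copy Z of the tail comes with a copy A of X such that A ≤ Z + n + 1: n for the values cut
    -- off, 1 for the approximation. Since φ kills constants, φ(Z) ≥ φ(A) ≥ c.
    obtain ⟨g, hg, hgX, hgZ⟩ := hμ.exists_identDistrib_abs_sub_le (measurable_coe X) hh
      (measurable_coe Z)
      (hZ.trans (IdentDistrib.of_ae_eq (measurable_coe _).aemeasurable (hu n))) one_pos
    obtain ⟨A, hAg, hAX⟩ := exists_coeFn_of_identDistrib X hgX
    have h1 := hφ0 (Z + ((n : ℝ) + 1) • I - A) (by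
      filter_upwards [hAg, hgZ, hI, hZ0, coeFn_sub (Z + ((n : ℝ) + 1) • I) A,
        coeFn_add Z (((n : ℝ) + 1) • I), coeFn_smul ((n : ℝ) + 1) I]
        with ω h1 h2 h3 h4 h5 h6 h7
      rw [h5, h6, h7, h3, h1]
      by_cases hω : g ω ∈ Set.Ioi (n : ℝ)
      · rw [Set.indicator_of_mem hω, id] at h2
        have := (abs_le.1 h2).2
        linarith
      · have : g ω ≤ n := not_lt.1 hω
        linarith)
    rw [map_sub, map_add, map_smul, hφa I hIa, smul_zero, add_zero] at h1
    have h2 := hφX A hAX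
    have h3 := hψ0 Z hZ0
    rw [add_apply]
    linarith
  have hfatou := h _ (isCoherentRiskMeasure_neg_lawInf hμ hI hΦ0 hΦI)
    (fun _ _ hXY => congrArg Neg.neg (lawInf_congr hXY)) u hconv
  have hle : liminf (fun n => ((-lawInf (ψ + φ) (u n) : ℝ) : EReal)) atTop ≤ ((-c : ℝ) : EReal) := by
    have : liminf (fun n => ((-lawInf (ψ + φ) (u n) : ℝ) : EReal)) atTop ≤
        liminf (fun _ : ℕ => ((-c : ℝ) : EReal)) atTop :=
      liminf_le_liminf (Eventually.of_forall fun n =>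
        EReal.coe_le_coe_iff.2 (neg_le_neg (hlow n)))
    rwa [liminf_const] at this
  have h0 : -lawInf (ψ + φ) 0 ≤ -c := EReal.coe_le_coe_iff.1 (hfatou.trans hle)
  rw [lawInf_zero] at h0
  linarith

/-! ### The three equivalences -/

theorem negPart_zero : negPart (0 : E.space) = 0 := by
  refine ext_ae ?_
  filter_upwards [coeFn_negPart (0 : E.space), coeFn_zero (E := E)] with ω h1 h2
  rw [h1, h2, neg_zero, max_self]

theorem IsCoherentRiskMeasure.convexOn {ρ : E.space → ℝ} (h : IsCoherentRiskMeasure ρ) :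
    ConvexOn ℝ Set.univ ρ := by
  refine ⟨convex_univ, fun X _ Y _ a b ha hb _ => (h.subadditive _ _).trans_eq ?_⟩
  rw [h.pos_homogeneous a X ha, h.pos_homogeneous b Y hb, smul_eq_mul, smul_eq_mul]

end RISpace

theorem theorem2p2 {Ω : Type*} [MeasurableSpace Ω] (μ : Measure Ω) [IsProbabilityMeasure μ]
    (hμ : IsNonatomic μ) (E : RISpace μ)
    (hE : (E.space : Set (Ω →ₘ[μ] ℝ)) ≠ (Lp ℝ ⊤ μ : Set (Ω →ₘ[μ] ℝ))) :
    List.TFAE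
      [∀ ρ : E.space → ℝ, RISpace.IsCoherentRiskMeasure ρ → RISpace.LawInvariant ρ →
          RISpace.FatouAt ρ 0,
       ∀ ρ : E.space → ℝ, ConvexOn ℝ Set.univ ρ → RISpace.IsDecreasing ρ →
          RISpace.LawInvariant ρ →
          ∀ X : E.space, RISpace.negPart X ∈ E.orderContinuousPart → RISpace.FatouAt ρ X,
       E.AOCEA] := by
  obtain ⟨I, hI⟩ := RISpace.exists_coeFn_eq_one hμ E
  have hIa := RISpace.one_mem_orderContinuousPart hμ hE hI
  tfae_have 1 → 3 := RISpace.AOCEA_of_forall_fatouAt hμ hI hIa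
  tfae_have 3 → 2 := fun h ρ hconv hdec hlaw X hX => h.fatouAt hμ hI hIa hconv hdec hlaw hX
  tfae_have 2 → 1 := fun h ρ hρ hlaw => h ρ hρ.convexOn hρ.decreasing hlaw 0 (by
    rw [RISpace.negPart_zero]
    exact RISpace.zero_mem_orderContinuousPart)
  tfae_finish
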